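/- Let $q\ge 1$ and let $\psi$ be a real non-principal Dirichlet character modulo $q$. Put $$\varphi(n,\psi)=n\prod_{p\mid n}\Bigl(1-\frac{\psi(p)}{p}\Bigr)\qquad(n\ge 1),$$ where $p$ runs over primes, and write $\{t\}$ for the fractional part of $t$ and $\mu$ for the Möbius function. Let $\epsilon>0$ be given. Then for all real $X\ge 1$ and $H$ with $2\le H\le X^{1-\epsilon}$, $$\frac1X\int_X^{2X}\Bigl|\sum_{x<n\le x+H}\frac{\varphi(n,\psi)}{n}-\frac{H}{L(2,\psi)}\Bigr|^2\,dx=c(H)+O\bigl(H^{-\epsilon}\bigr),$$ where the implied constant depends at most on $\epsilon$ and $\psi$, and $$c(H)=\sum_{\substack{d=1\\(d,q)=1}}^{\infty}\frac{\mu^2(d)}{d^2}\prod_{p\nmid d}\Bigl(1-\frac{2\psi(p)}{p^2}\Bigr)\Bigl(\Bigl\{\frac Hd\Bigr\}-\Bigl\{\frac Hd\Bigr\}^2\Bigr).$$ Here the infinite products and the series converge absolutely. -/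

import Mathlib

namespace TwistedTotient

noncomputable section

/-- The Euler totient function twisted by a Dirichlet character `ψ`:
`φ(n, ψ) = n ∏_{p ∣ n} (1 - ψ(p) / p)`. -/
def totient {q : ℕ} (ψ : DirichletCharacter ℂ q) (n : ℕ) : ℂ :=
  n * ∏ p ∈ n.primeFactors, (1 - ψ p / p)

/-- The difference `∑_{x < n ≤ x + H} φ(n, ψ) / n - H / L(2, ψ)` (for `x, H ≥ 0`). -/
def shortSumError {q : ℕ} [NeZero q] (ψ : DirichletCharacter ℂ q) (H x : ℝ) : ℂ :=
  ∑ n ∈ Finset.Ioc ⌊x⌋₊ ⌊x + H⌋₊, totient ψ n / n - H / ψ.LFunction 2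

/-- The variance `(1 / X) ∫_X^{2X} |∑_{x < n ≤ x + H} φ(n, ψ) / n - H / L(2, ψ)|² dx`. -/
def variance {q : ℕ} [NeZero q] (ψ : DirichletCharacter ℂ q) (X H : ℝ) : ℝ :=
  1 / X * ∫ x in X..2 * X, ‖shortSumError ψ H x‖ ^ 2

/-- The factor at the prime `p` of the product `∏_{p ∤ d} (1 - 2 ψ(p) / p²)`; it is `1` at the
primes dividing `d`. -/
def eulerFactor {q : ℕ} (ψ : DirichletCharacter ℂ q) (d : ℕ) (p : Nat.Primes) : ℂ :=
  if (p : ℕ) ∣ d then 1 else 1 - 2 * ψ (p : ℕ) / (p : ℂ) ^ 2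

/-- The `d`-th term of the series `c(H)`; it vanishes unless `(d, q) = 1`, and it vanishes at
`d = 0` because `μ(0) = 0`. -/
def constantTerm {q : ℕ} (ψ : DirichletCharacter ℂ q) (H : ℝ) (d : ℕ) : ℂ :=
  if d.Coprime q then
    (ArithmeticFunction.moebius d : ℂ) ^ 2 / (d : ℂ) ^ 2 * (∏' p : Nat.Primes, eulerFactor ψ d p) *
      ((Int.fract (H / d) - Int.fract (H / d) ^ 2 : ℝ) : ℂ)
  else 0

/-- The constant
`c(H) = ∑_{d ≥ 1, (d, q) = 1} μ²(d) / d² ∏_{p ∤ d} (1 - 2 ψ(p) / p²) ({H / d} - {H / d}²)`. -/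
def constant {q : ℕ} (ψ : DirichletCharacter ℂ q) (H : ℝ) : ℂ :=
  ∑' d : ℕ, constantTerm ψ H d

end

end TwistedTotient

/-! Expanding over divisors, `φ(n, ψ) / n = ∑_{d ∣ n} a_d` with `a_d = μ(d) ψ(d) / d`, and the
multiples of `d` in `(x, x + H]` number `H / d - ({(x + H) / d} - {x / d})`. Since `∑ a_d / d = 1 /
L(2, ψ)`, as soon as `D ≥ x + H` the error is exactly minus a sum over `d ≤ D` of sawtooth
differences with weights `a_d`, minus `H` times a small tail (`shortSumError_eq`).

The sawtooth differences are expanded in cosines of frequencies `k / d`, all centred at the same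
point `-H / 2`. In the mean square, equal frequencies `k / d = l / e` give the main term by Parseval
(`tendsto_sum_sawCoeff_mul_sawCoeff`). Distinct frequencies contribute at most `1 / |k / d - l / e|
+ 1 / (k / d + l / e)`; as `|k / d - l / e| = |k e - l d| / (d e)`, the sizes of the coefficients
and the divisor bound make the sum of absolute values `O(H D ^ (8 η))`
(`exists_abs_integral_sawSum_sq_sub_le`). Only `|a_d| ≤ 1 / d` is needed here. With `D` of order
`X`, division by `X` leaves `H X ^ (8 η - 1)`, which is at most `H ^ (-ε)` for `8 η = ε ^ 2` and `H
≤ X ^ (1 - ε)`.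

The main term is a double series over `(d, e)`. Grouping by the gcd, `(d, e) = (g a, g b)`, the
factor `ψ(g) ^ 2` becomes the condition `(g, q) = 1` because `ψ` is real, and the sum over `a, b`
becomes the Euler product of `c(H)` (`hasSum_constantTerm`). Completing the truncated series costs
`O(H D ^ (-1 + 2 η))`. -/

namespace TwistedTotient

/-! ### Divisor bound and off-diagonal sums of Hilbert type -/

open Finset

/-- The divisor bound `d(n) ≪ n ^ η`. -/
theorem exists_card_divisors_le_rpow {η : ℝ} (hη : 0 < η) :
    ∃ C : ℝ, 1 ≤ C ∧ ∀ n : ℕ, n ≠ 0 → (n.divisors.card : ℝ) ≤ C * (n : ℝ) ^ η := by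
  have hlog : 0 < Real.log 2 := Real.log_pos (by norm_num)
  -- `A` is the loss allowed at each small prime: `2 ^ (k η) ≥ 1 + k η log 2`, so `A · 2 ^ (k η) ≥ 1
  -- + k`.
  set A : ℝ := max 1 (1 / (η * Real.log 2)) with hA
  have hA1 : 1 ≤ A := le_max_left _ _
  have hA2 : 1 ≤ A * (η * Real.log 2) := by
    have := le_max_right 1 (1 / (η * Real.log 2))
    rwa [div_le_iff₀ (by positivity)] at this
  -- From `P` on, `p ^ η ≥ 2`, hence `k + 1 ≤ 2 ^ k ≤ p ^ (k η)` without loss; at most `P` primes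
  -- lie below.
  set P : ℕ := ⌈(2 : ℝ) ^ (1 / η)⌉₊ with hP
  have hsmall (p k : ℕ) (hp : 2 ≤ p) : ((k : ℝ) + 1) ≤ A * ((p : ℝ) ^ k) ^ η := by
    have h1 : ((2 : ℝ) ^ k) ^ η ≤ ((p : ℝ) ^ k) ^ η := by
      have : (2 : ℝ) ≤ p := by exact_mod_cast hp
      gcongr
    have h2 : 1 + k * (η * Real.log 2) ≤ ((2 : ℝ) ^ k) ^ η := by
      rw [Real.rpow_def_of_pos (by positivity), Real.log_pow]
      have := Real.add_one_le_exp (k * Real.log 2 * η)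
      linarith
    have hk : (0 : ℝ) ≤ k := k.cast_nonneg
    nlinarith
  have hlarge (p k : ℕ) (hp : P ≤ p) : ((k : ℝ) + 1) ≤ ((p : ℝ) ^ k) ^ η := by
    have h1 : (2 : ℝ) ^ (1 / η) ≤ p := (Nat.le_ceil _).trans (by exact_mod_cast hp)
    have h2 : (2 : ℝ) ≤ (p : ℝ) ^ η := by
      calc (2 : ℝ) = ((2 : ℝ) ^ (1 / η)) ^ η := by
            rw [← Real.rpow_mul (by norm_num), one_div_mul_cancel hη.ne', Real.rpow_one]
        _ ≤ _ := by gcongr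
    calc (k : ℝ) + 1 ≤ 2 ^ k := by exact_mod_cast Nat.lt_two_pow_self
      _ ≤ ((p : ℝ) ^ η) ^ k := by gcongr
      _ = _ := by rw [← Real.rpow_natCast, ← Real.rpow_natCast, ← Real.rpow_mul (by positivity),
          ← Real.rpow_mul (by positivity), mul_comm]
  refine ⟨A ^ P, one_le_pow₀ hA1, fun n hn => ?_⟩
  have hn' : (n : ℝ) ^ η = ∏ p ∈ n.primeFactors, ((p : ℝ) ^ n.factorization p) ^ η := by
    rw [Real.finsetProd_rpow _ _ (fun _ _ => by positivity)]
    congr 1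
    conv_lhs => rw [← Nat.prod_factorization_pow_eq_self hn]
    simp [Finsupp.prod]
  rw [Nat.card_divisors hn, hn']
  push_cast
  calc ∏ p ∈ n.primeFactors, ((n.factorization p : ℝ) + 1)
      ≤ ∏ p ∈ n.primeFactors, (if p < P then A else 1) * ((p : ℝ) ^ n.factorization p) ^ η := by
        refine prod_le_prod (fun _ _ => by positivity) fun p hp => ?_
        split_ifs with h
        · exact hsmall p _ (Nat.prime_of_mem_primeFactors hp).two_le
        · rw [one_mul]; exact hlarge p _ (not_lt.mp h)
    _ = (∏ p ∈ n.primeFactors, if p < P then A else 1) *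
          ∏ p ∈ n.primeFactors, ((p : ℝ) ^ n.factorization p) ^ η := prod_mul_distrib
    _ ≤ A ^ P * ∏ p ∈ n.primeFactors, ((p : ℝ) ^ n.factorization p) ^ η := by
        refine mul_le_mul_of_nonneg_right ?_ (prod_nonneg fun _ _ => by positivity)
        rw [← prod_filter, prod_const]
        refine pow_le_pow_right₀ hA1 ?_
        calc _ ≤ (range P).card := card_le_card fun p hp => by simpa using (mem_filter.mp hp).2
          _ = P := card_range P

/-- The value at `1 + η` of the zeta function, as a real series. -/
noncomputable def zetaValue (η : ℝ) : ℝ := ∑' n : ℕ, (n : ℝ) ^ (-1 - η)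

theorem summable_rpow_neg_one_sub {η : ℝ} (hη : 0 < η) :
    Summable fun n : ℕ => (n : ℝ) ^ (-1 - η) :=
  Real.summable_nat_rpow.mpr (by linarith)

theorem zetaValue_nonneg (η : ℝ) : 0 ≤ zetaValue η := tsum_nonneg fun _ => by positivity

theorem sum_rpow_le_zetaValue {η : ℝ} (hη : 0 < η) (s : Finset ℕ) :
    ∑ n ∈ s, (n : ℝ) ^ (-1 - η) ≤ zetaValue η :=
  (summable_rpow_neg_one_sub hη).sum_le_tsum _ fun _ _ => by positivity

/-- The subtraction is truncated and `0` to a nonzero power is `0`, so only `v > u` contributes, and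
there `v ↦ v - u` is injective. -/
theorem sum_sub_rpow_le_zetaValue {η : ℝ} (hη : 0 < η) (s : Finset ℕ) (u : ℕ) :
    ∑ v ∈ s, ((v - u : ℕ) : ℝ) ^ (-1 - η) ≤ zetaValue η := by
  have h0 : ∑ v ∈ s, ((v - u : ℕ) : ℝ) ^ (-1 - η) =
      ∑ v ∈ s with u < v, ((v - u : ℕ) : ℝ) ^ (-1 - η) := by
    rw [sum_filter]
    refine sum_congr rfl fun v _ => ?_
    split_ifs with h
    · rfl
    · rw [Nat.sub_eq_zero_of_le (not_lt.mp h), Nat.cast_zero, Real.zero_rpow (by linarith)]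
  rw [h0, ← sum_image (f := fun n : ℕ => (n : ℝ) ^ (-1 - η)) (g := fun v => v - u)]
  · exact sum_rpow_le_zetaValue hη _
  · intro v hv w hw h
    simp only [coe_filter, Set.mem_ofPred_eq] at hv hw
    simp only at h
    lia

/-- The kernel `1 / |u - v| + 1 / (u + v)`, with the convention `1 / 0 = 0`. -/
noncomputable def hilbertKernel (u v : ℝ) : ℝ := 1 / |u - v| + 1 / (u + v)

theorem hilbertKernel_nonneg {u v : ℝ} (hu : 0 ≤ u) (hv : 0 ≤ v) : 0 ≤ hilbertKernel u v := by
  unfold hilbertKernel; positivity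

/-- Since `v` exceeds both `u` and `v - u`, the factor `v ^ (-1/2 - η)` is at most `u ^ (-1/2) (v -
u) ^ (-η)`. The right-hand side then separates into two convergent sums. -/
theorem rpow_mul_one_div_sub_le {η : ℝ} (hη : 0 < η) {u v : ℕ} (hu : 0 < u) (huv : u < v) :
    ((u : ℝ) * v) ^ (-(1 / 2) - η) * (1 / |(u : ℝ) - v|) ≤
      (u : ℝ) ^ (-1 - η) * ((v - u : ℕ) : ℝ) ^ (-1 - η) := by
  obtain ⟨h, rfl⟩ := Nat.exists_eq_add_of_lt huv
  have e1 : (u + h + 1 - u : ℕ) = h + 1 := by lia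
  rw [e1]
  set w : ℝ := ((h + 1 : ℕ) : ℝ) with hw
  have hw0 : 0 < w := by rw [hw]; positivity
  have hu0 : (0 : ℝ) < u := by exact_mod_cast hu
  have e2 : ((u + h + 1 : ℕ) : ℝ) = u + w := by rw [hw]; push_cast; ring
  rw [e2, show (u : ℝ) - (u + w) = -w by ring, abs_neg, abs_of_pos hw0,
    Real.mul_rpow hu0.le (by positivity)]
  have h1 : ((u : ℝ) + w) ^ (-(1 / 2) - η) ≤ (u : ℝ) ^ (-(1 / 2) : ℝ) * w ^ (-η) := by
    rw [sub_eq_add_neg, Real.rpow_add (by positivity)]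
    refine mul_le_mul ?_ ?_ (by positivity) (by positivity)
    · exact Real.rpow_le_rpow_of_nonpos hu0 (by linarith) (by norm_num)
    · exact Real.rpow_le_rpow_of_nonpos hw0 (by linarith) (by linarith)
  calc _ ≤ (u : ℝ) ^ (-(1 / 2) - η) * ((u : ℝ) ^ (-(1 / 2) : ℝ) * w ^ (-η)) * (1 / w) := by gcongr
    _ = ((u : ℝ) ^ (-(1 / 2) - η) * (u : ℝ) ^ (-(1 / 2) : ℝ)) * (w ^ (-η) * w ^ (-1 : ℝ)) := by
        rw [Real.rpow_neg_one]; ring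
    _ = _ := by rw [← Real.rpow_add hu0, ← Real.rpow_add hw0]; congr 2 <;> ring

theorem rpow_mul_hilbertKernel_le {η : ℝ} (hη : 0 < η) {u v : ℕ} (hu : 0 < u) (hv : 0 < v) :
    ((u : ℝ) * v) ^ (-(1 / 2) - η) * hilbertKernel u v ≤
      (u : ℝ) ^ (-1 - η) * ((v - u : ℕ) : ℝ) ^ (-1 - η) +
      (v : ℝ) ^ (-1 - η) * ((u - v : ℕ) : ℝ) ^ (-1 - η) +
      (u : ℝ) ^ (-1 - η) * (v : ℝ) ^ (-1 - η) := by
  have hu0 : (0 : ℝ) < u := by exact_mod_cast hu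
  have hv0 : (0 : ℝ) < v := by exact_mod_cast hv
  rw [hilbertKernel, mul_add]
  refine add_le_add ?_ ?_
  · rcases lt_trichotomy u v with h | rfl | h
    · exact (rpow_mul_one_div_sub_le hη hu h).trans (le_add_of_nonneg_right (by positivity))
    · simp only [sub_self, abs_zero, div_zero, mul_zero]; positivity
    · have := rpow_mul_one_div_sub_le hη hv h
      rw [mul_comm (v : ℝ) u, abs_sub_comm] at this
      exact this.trans (le_add_of_nonneg_left (by positivity))
  · rw [← Real.mul_rpow hu0.le hv0.le]
    -- `√(u v) ≤ u + v`.
    have h1 : 1 / ((u : ℝ) + v) ≤ ((u : ℝ) * v) ^ (-(1 / 2) : ℝ) := by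
      rw [Real.rpow_neg (by positivity), ← one_div, ← Real.sqrt_eq_rpow]
      refine one_div_le_one_div_of_le (by positivity) ?_
      rw [Real.sqrt_le_left (by positivity)]
      nlinarith
    calc _ ≤ ((u : ℝ) * v) ^ (-(1 / 2) - η) * ((u : ℝ) * v) ^ (-(1 / 2) : ℝ) := by gcongr
      _ = _ := by rw [← Real.rpow_add (by positivity)]; congr 1; ring

theorem sum_rpow_mul_hilbertKernel_le {η : ℝ} (hη : 0 < η) (N : ℕ) :
    ∑ u ∈ Icc 1 N, ∑ v ∈ Icc 1 N, ((u : ℝ) * v) ^ (-(1 / 2) - η) * hilbertKernel u v ≤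
      3 * zetaValue η ^ 2 := by
  have hz := zetaValue_nonneg η
  have key (f : ℕ → ℝ) (g : ℕ → ℕ → ℝ) (hf : f = fun n : ℕ => (n : ℝ) ^ (-1 - η))
      (hg : ∀ u, ∑ v ∈ Icc 1 N, g u v ≤ zetaValue η) :
      ∑ u ∈ Icc 1 N, ∑ v ∈ Icc 1 N, f u * g u v ≤ zetaValue η ^ 2 := by
    subst hf
    calc _ = ∑ u ∈ Icc 1 N, (u : ℝ) ^ (-1 - η) * ∑ v ∈ Icc 1 N, g u v := by simp_rw [mul_sum]
      _ ≤ ∑ u ∈ Icc 1 N, (u : ℝ) ^ (-1 - η) * zetaValue η := by gcongr with u _; exact hg u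
      _ = (∑ u ∈ Icc 1 N, (u : ℝ) ^ (-1 - η)) * zetaValue η := by rw [sum_mul]
      _ ≤ zetaValue η * zetaValue η := by gcongr; exact sum_rpow_le_zetaValue hη _
      _ = _ := by ring
  calc _ ≤ ∑ u ∈ Icc 1 N, ∑ v ∈ Icc 1 N, ((u : ℝ) ^ (-1 - η) * ((v - u : ℕ) : ℝ) ^ (-1 - η) +
      (v : ℝ) ^ (-1 - η) * ((u - v : ℕ) : ℝ) ^ (-1 - η) +
      (u : ℝ) ^ (-1 - η) * (v : ℝ) ^ (-1 - η)) := by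
        refine sum_le_sum fun u hu => sum_le_sum fun v hv => ?_
        exact rpow_mul_hilbertKernel_le hη (mem_Icc.mp hu).1 (mem_Icc.mp hv).1
    _ = ∑ u ∈ Icc 1 N, ∑ v ∈ Icc 1 N, (u : ℝ) ^ (-1 - η) * ((v - u : ℕ) : ℝ) ^ (-1 - η) +
        ∑ v ∈ Icc 1 N, ∑ u ∈ Icc 1 N, (v : ℝ) ^ (-1 - η) * ((u - v : ℕ) : ℝ) ^ (-1 - η) +
        ∑ u ∈ Icc 1 N, ∑ v ∈ Icc 1 N, (u : ℝ) ^ (-1 - η) * (v : ℝ) ^ (-1 - η) := by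
        simp_rw [sum_add_distrib]
        congr 2
        exact sum_comm
    _ ≤ zetaValue η ^ 2 + zetaValue η ^ 2 + zetaValue η ^ 2 := by
        refine add_le_add (add_le_add ?_ ?_) ?_
        · exact key _ (fun u v => ((v - u : ℕ) : ℝ) ^ (-1 - η)) rfl
            fun u => sum_sub_rpow_le_zetaValue hη _ u
        · exact key _ (fun u v => ((v - u : ℕ) : ℝ) ^ (-1 - η)) rfl
            fun u => sum_sub_rpow_le_zetaValue hη _ u
        · exact key _ (fun u v => (v : ℝ) ^ (-1 - η)) rfl fun u => sum_rpow_le_zetaValue hη _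
    _ = _ := by ring

/-- A given `u` arises as a product at most once for each of its divisors. -/
theorem sum_product_mul_le (K D : ℕ) (G : ℕ → ℝ) (hG : ∀ n, 0 ≤ G n) :
    ∑ p ∈ Icc 1 K ×ˢ Icc 1 D, G (p.1 * p.2) ≤
      ∑ u ∈ Icc 1 (K * D), (u.divisors.card : ℝ) * G u := by
  have hmaps : ∀ p ∈ Icc 1 K ×ˢ Icc 1 D, p.1 * p.2 ∈ Icc 1 (K * D) := by
    intro p hp
    simp only [mem_product, mem_Icc] at hp ⊢
    exact ⟨Nat.mul_pos hp.1.1 hp.2.1, Nat.mul_le_mul hp.1.2 hp.2.2⟩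
  rw [← sum_fiberwise_of_maps_to hmaps]
  refine sum_le_sum fun u hu => ?_
  calc _ = ∑ p ∈ Icc 1 K ×ˢ Icc 1 D with p.1 * p.2 = u, G u :=
        sum_congr rfl fun p hp => by rw [(mem_filter.mp hp).2]
    _ = (#{p ∈ Icc 1 K ×ˢ Icc 1 D | p.1 * p.2 = u} : ℝ) * G u := by
        rw [sum_const, nsmul_eq_mul]
    _ ≤ _ := by
        refine mul_le_mul_of_nonneg_right ?_ (hG u)
        refine Nat.cast_le.mpr (card_le_card_of_injOn Prod.fst (fun p hp => ?_) ?_)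
        · have h := (mem_filter.mp hp).2
          exact Nat.mem_divisors.mpr ⟨⟨_, h.symm⟩, by have := (mem_Icc.mp hu).1; lia⟩
        · rintro ⟨a, b⟩ hp ⟨a', b'⟩ hp' (rfl : a = a')
          have h := (mem_filter.mp hp).2
          have h' := (mem_filter.mp hp').2
          have ha := (mem_Icc.mp (mem_product.mp (mem_filter.mp hp).1).1).1
          rw [Prod.mk.injEq]
          exact ⟨rfl, Nat.eq_of_mul_eq_mul_left ha (h.trans h'.symm)⟩

/-- The off-diagonal sum over pairs of products. -/
theorem exists_sum_product_hilbertKernel_le {η : ℝ} (hη : 0 < η) :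
    ∃ C : ℝ, 0 ≤ C ∧ ∀ K D : ℕ,
      ∑ p ∈ Icc 1 K ×ˢ Icc 1 D, ∑ t ∈ Icc 1 K ×ˢ Icc 1 D,
        (((p.1 * p.2 : ℕ) : ℝ) * (t.1 * t.2 : ℕ)) ^ (-(1 / 2) - 2 * η) *
          hilbertKernel (p.1 * p.2 : ℕ) (t.1 * t.2 : ℕ) ≤ C := by
  obtain ⟨C, hC, hdiv⟩ := exists_card_divisors_le_rpow hη
  refine ⟨C ^ 2 * (3 * zetaValue η ^ 2), by positivity, fun K D => ?_⟩
  set F : ℕ → ℕ → ℝ := fun u v =>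
    ((u : ℝ) * v) ^ (-(1 / 2) - 2 * η) * hilbertKernel u v with hF
  have hF0 (u v : ℕ) : 0 ≤ F u v :=
    mul_nonneg (by positivity) (hilbertKernel_nonneg u.cast_nonneg v.cast_nonneg)
  calc _ = ∑ p ∈ Icc 1 K ×ˢ Icc 1 D, ∑ t ∈ Icc 1 K ×ˢ Icc 1 D, F (p.1 * p.2) (t.1 * t.2) := rfl
    _ ≤ ∑ p ∈ Icc 1 K ×ˢ Icc 1 D, ∑ v ∈ Icc 1 (K * D),
          (v.divisors.card : ℝ) * F (p.1 * p.2) v :=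
        sum_le_sum fun p _ => sum_product_mul_le K D _ fun v => hF0 _ v
    _ ≤ ∑ u ∈ Icc 1 (K * D), (u.divisors.card : ℝ) * ∑ v ∈ Icc 1 (K * D),
          (v.divisors.card : ℝ) * F u v :=
        sum_product_mul_le K D (fun u => ∑ v ∈ Icc 1 (K * D), (v.divisors.card : ℝ) * F u v)
          fun u => sum_nonneg fun v _ => mul_nonneg (by positivity) (hF0 _ _)
    _ ≤ ∑ u ∈ Icc 1 (K * D), ∑ v ∈ Icc 1 (K * D),
          C ^ 2 * (((u : ℝ) * v) ^ (-(1 / 2) - η) * hilbertKernel u v) := by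
        -- Half of the exponent `2 η` pays for the two divisor functions; the other half keeps the
        -- sums over `u` and `v` convergent.
        refine sum_le_sum fun u hu => ?_
        rw [mul_sum]
        refine sum_le_sum fun v hv => ?_
        have hu := (mem_Icc.mp hu).1
        have hv := (mem_Icc.mp hv).1
        have hu0 : (0 : ℝ) < u := by exact_mod_cast hu
        have hv0 : (0 : ℝ) < v := by exact_mod_cast hv
        have h0 := hilbertKernel_nonneg hu0.le hv0.le
        calc _ ≤ (C * (u : ℝ) ^ η) * ((C * (v : ℝ) ^ η) * F u v) := by
              have := hF0 u v
              have := hdiv u (by lia)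
              have := hdiv v (by lia)
              gcongr
          _ = C ^ 2 * ((((u : ℝ) * v) ^ η * ((u : ℝ) * v) ^ (-(1 / 2) - 2 * η)) *
                hilbertKernel u v) := by
              rw [Real.mul_rpow hu0.le hv0.le (z := η), hF]; ring
          _ = _ := by
              rw [← Real.rpow_add (by positivity)]
              congr 3; ring
    _ = C ^ 2 * ∑ u ∈ Icc 1 (K * D), ∑ v ∈ Icc 1 (K * D),
          ((u : ℝ) * v) ^ (-(1 / 2) - η) * hilbertKernel u v := by simp_rw [mul_sum]
    _ ≤ _ := by gcongr; exact sum_rpow_mul_hilbertKernel_le hη _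

end TwistedTotient

/-! ### Fourier expansion of sawtooth differences in mean square -/

namespace TwistedTotient

open Finset Filter Topology MeasureTheory intervalIntegral

/-- The difference `{t + a} - {t}` of two sawtooth functions. -/
noncomputable def sawDiff (a t : ℝ) : ℝ := Int.fract (t + a) - Int.fract t

/-- Minus the `k`-th cosine coefficient of `sawDiff a` around the point `-a / 2`. -/
noncomputable def sawCoeff (a : ℝ) (k : ℕ) : ℝ := 2 * Real.sin (Real.pi * k * a) / (Real.pi * k)

/-- The partial sums of the Fourier series of `sawDiff a`. -/
noncomputable def sawPartial (a : ℝ) (K : ℕ) (t : ℝ) : ℝ :=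
  -∑ k ∈ Icc 1 K, sawCoeff a k * Real.cos (2 * Real.pi * k * t + Real.pi * k * a)

theorem measurable_sawDiff (a : ℝ) : Measurable (sawDiff a) := by
  unfold sawDiff
  exact (measurable_fract.comp (measurable_id.add_const a)).sub measurable_fract

theorem abs_sawDiff_le (a t : ℝ) : |sawDiff a t| ≤ 1 := by
  have h1 := Int.fract_nonneg (t + a)
  have h2 := (Int.fract_lt_one (t + a)).le
  have h3 := Int.fract_nonneg t
  have h4 := (Int.fract_lt_one t).le
  rw [sawDiff, abs_le]
  constructor <;> linarith

theorem sawDiff_periodic (a : ℝ) : Function.Periodic (sawDiff a) 1 := by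
  intro t
  simp only [sawDiff, add_right_comm t 1 a, Int.fract_add_one]

theorem sawPartial_periodic (a : ℝ) (K : ℕ) : Function.Periodic (sawPartial a K) 1 := by
  intro t
  simp only [sawPartial]
  congr 1
  refine sum_congr rfl fun k _ => ?_
  rw [show 2 * Real.pi * k * (t + 1) + Real.pi * k * a =
    2 * Real.pi * k * t + Real.pi * k * a + (k : ℕ) * (2 * Real.pi) by ring,
    Real.cos_add_nat_mul_two_pi]

theorem continuous_sawPartial (a : ℝ) (K : ℕ) : Continuous (sawPartial a K) := by
  unfold sawPartial; fun_prop

theorem intervalIntegrable_of_measurable_of_abs_le {f : ℝ → ℝ} {M : ℝ} (hf : Measurable f)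
    (hM : ∀ t, |f t| ≤ M) (a b : ℝ) : IntervalIntegrable f volume a b := by
  refine (intervalIntegrable_const (c := M)).mono_fun hf.aestronglyMeasurable ?_
  refine Eventually.of_forall fun t => ?_
  exact (hM t).trans (le_abs_self M)

theorem intervalIntegrable_sub_sq {f g : ℝ → ℝ} {M : ℝ} (hf : Measurable f)
    (hM : ∀ t, |f t| ≤ M) (hg : Continuous g) (a b : ℝ) :
    IntervalIntegrable (fun t => (f t - g t) ^ 2) volume a b := by
  have h1 : IntervalIntegrable (fun t => f t ^ 2) volume a b := by
    refine intervalIntegrable_of_measurable_of_abs_le (M := M ^ 2) (hf.pow_const 2) (fun t => ?_) _ _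
    rw [abs_pow]
    exact pow_le_pow_left₀ (abs_nonneg _) (hM t) 2
  have h2 := intervalIntegrable_of_measurable_of_abs_le hf hM a b
  have h3 : IntervalIntegrable (fun t => g t ^ 2) volume a b := (hg.pow 2).intervalIntegrable _ _
  refine ((h1.sub ((h2.continuousOn_mul hg.continuousOn).const_mul 2)).add h3).congr fun t _ => ?_
  ring

theorem integral_cos_int_mul_add {m : ℤ} (hm : m ≠ 0) (φ : ℝ) :
    ∫ t in (0 : ℝ)..1, Real.cos (2 * Real.pi * m * t + φ) = 0 := by
  have hc : 2 * Real.pi * (m : ℝ) ≠ 0 := by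
    have : (m : ℝ) ≠ 0 := by exact_mod_cast hm
    have := Real.pi_ne_zero
    positivity
  rw [integral_comp_mul_add (fun t => Real.cos t) hc φ, integral_cos]
  rw [show 2 * Real.pi * (m : ℝ) * 1 + φ = φ + m * (2 * Real.pi) by ring,
    Real.sin_add_int_mul_two_pi]
  simp

theorem integral_cos_mul_cos {k l : ℕ} (hk : k ≠ 0) (hl : l ≠ 0) (a : ℝ) :
    ∫ t in (0 : ℝ)..1, Real.cos (2 * Real.pi * k * t + Real.pi * k * a) *
      Real.cos (2 * Real.pi * l * t + Real.pi * l * a) = if k = l then 1 / 2 else 0 := by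
  have e (t : ℝ) : Real.cos (2 * Real.pi * k * t + Real.pi * k * a) *
      Real.cos (2 * Real.pi * l * t + Real.pi * l * a) =
      1 / 2 * (Real.cos (2 * Real.pi * ((k - l : ℤ) : ℝ) * t + Real.pi * (k - l) * a) +
        Real.cos (2 * Real.pi * ((k + l : ℤ) : ℝ) * t + Real.pi * (k + l) * a)) := by
    have := Real.two_mul_cos_mul_cos (2 * Real.pi * k * t + Real.pi * k * a)
      (2 * Real.pi * l * t + Real.pi * l * a)
    push_cast
    rw [show 2 * Real.pi * ((k : ℝ) - l) * t + Real.pi * (k - l) * a =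
      2 * Real.pi * k * t + Real.pi * k * a - (2 * Real.pi * l * t + Real.pi * l * a) by ring,
      show 2 * Real.pi * ((k : ℝ) + l) * t + Real.pi * (k + l) * a =
      2 * Real.pi * k * t + Real.pi * k * a + (2 * Real.pi * l * t + Real.pi * l * a) by ring]
    linarith
  simp_rw [e]
  rw [intervalIntegral.integral_const_mul, intervalIntegral.integral_add
    (Continuous.intervalIntegrable (by fun_prop) _ _)
    (Continuous.intervalIntegrable (by fun_prop) _ _),
    integral_cos_int_mul_add (m := (k : ℤ) + l) (by lia)]
  split_ifs with h
  · subst h; simp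
  · rw [integral_cos_int_mul_add (by lia)]; simp

theorem integral_id_mul_cos {k : ℕ} (hk : k ≠ 0) (φ : ℝ) :
    ∫ t in (0 : ℝ)..1, t * Real.cos (2 * Real.pi * k * t + φ) =
      Real.sin φ / (2 * Real.pi * k) := by
  have hc : 2 * Real.pi * (k : ℝ) ≠ 0 := by
    have := Real.pi_ne_zero
    positivity
  have hd (t : ℝ) : HasDerivAt (fun t : ℝ => t * (Real.sin (2 * Real.pi * k * t + φ) /
      (2 * Real.pi * k)) + Real.cos (2 * Real.pi * k * t + φ) / (2 * Real.pi * k) ^ 2)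
      (t * Real.cos (2 * Real.pi * k * t + φ)) t := by
    have h1 : HasDerivAt (fun t : ℝ => 2 * Real.pi * k * t + φ) (2 * Real.pi * k) t := by
      simpa using ((hasDerivAt_id t).const_mul (2 * Real.pi * k)).add_const φ
    have h2 := ((hasDerivAt_id t).mul (h1.sin.div_const (2 * Real.pi * k))).add
      (h1.cos.div_const ((2 * Real.pi * k) ^ 2))
    refine h2.congr_deriv ?_
    simp only [id_eq]
    field_simp
    ring
  rw [integral_eq_sub_of_hasDerivAt (fun t _ => hd t)
    (Continuous.intervalIntegrable (by fun_prop) _ _)]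
  rw [show 2 * Real.pi * (k : ℝ) * 1 + φ = φ + k * (2 * Real.pi) by ring,
    Real.sin_add_nat_mul_two_pi, Real.cos_add_nat_mul_two_pi]
  simp

theorem integral_fract_mul_cos {k : ℕ} (hk : k ≠ 0) (φ : ℝ) :
    ∫ t in (0 : ℝ)..1, Int.fract t * Real.cos (2 * Real.pi * k * t + φ) =
      Real.sin φ / (2 * Real.pi * k) := by
  rw [← integral_id_mul_cos hk φ]
  refine integral_congr_ae ?_
  have : ∀ᵐ t : ℝ, t ≠ 1 := by simp [ae_iff, measure_singleton]
  filter_upwards [this] with t ht hmem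
  rw [Set.uIoc_of_le zero_le_one] at hmem
  rw [Int.fract_eq_self.mpr ⟨hmem.1.le, lt_of_le_of_ne hmem.2 ht⟩]

theorem integral_fract_add_mul_cos {k : ℕ} (hk : k ≠ 0) (a φ : ℝ) :
    ∫ t in (0 : ℝ)..1, Int.fract (t + a) * Real.cos (2 * Real.pi * k * t + φ) =
      Real.sin (φ - 2 * Real.pi * k * a) / (2 * Real.pi * k) := by
  set G : ℝ → ℝ := fun t => Int.fract t * Real.cos (2 * Real.pi * k * t + (φ - 2 * Real.pi * k * a))
  have hG : Function.Periodic G 1 := by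
    intro t
    simp only [G, Int.fract_add_one]
    rw [show 2 * Real.pi * k * (t + 1) + (φ - 2 * Real.pi * k * a) =
      2 * Real.pi * k * t + (φ - 2 * Real.pi * k * a) + (k : ℕ) * (2 * Real.pi) by ring,
      Real.cos_add_nat_mul_two_pi]
  calc _ = ∫ t in (0 : ℝ)..1, G (t + a) := by
        refine integral_congr fun t _ => ?_
        simp only [G]
        congr 2; ring
    _ = ∫ t in a..a + 1, G t := by rw [integral_comp_add_right]; congr 1 <;> ring
    _ = ∫ t in (0 : ℝ)..0 + 1, G t := hG.intervalIntegral_add_eq a 0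
    _ = _ := by rw [zero_add]; exact integral_fract_mul_cos hk _

theorem integral_sawDiff_mul_cos (a : ℝ) {k : ℕ} (hk : k ≠ 0) :
    ∫ t in (0 : ℝ)..1, sawDiff a t * Real.cos (2 * Real.pi * k * t + Real.pi * k * a) =
      -(sawCoeff a k / 2) := by
  have hb (b : ℝ) : IntervalIntegrable (fun t => Int.fract (t + b) *
      Real.cos (2 * Real.pi * k * t + Real.pi * k * a)) volume 0 1 := by
    refine intervalIntegrable_of_measurable_of_abs_le (M := 1) ?_ (fun t => ?_) _ _
    · exact (measurable_fract.comp (measurable_id.add_const b)).mul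
        (Continuous.measurable (by fun_prop))
    · rw [abs_mul, abs_of_nonneg (Int.fract_nonneg _)]
      exact mul_le_one₀ (Int.fract_lt_one _).le (abs_nonneg _) (Real.abs_cos_le_one _)
  have hb0 := hb 0
  simp only [add_zero] at hb0
  simp only [sawDiff, sub_mul]
  rw [intervalIntegral.integral_sub (hb a) hb0, integral_fract_add_mul_cos hk,
    integral_fract_mul_cos hk, show Real.pi * k * a - 2 * Real.pi * k * a = -(Real.pi * k * a) by
    ring, Real.sin_neg, sawCoeff]
  have := Real.pi_ne_zero
  field_simp
  ring

/-- With `τ = {a}`, the function equals `τ` on `[0, 1 - τ)` and `τ - 1` on `[1 - τ, 1)`, and `τ² (1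
- τ) + (1 - τ)² τ = τ - τ²`. -/
theorem integral_sawDiff_sq (a : ℝ) :
    ∫ t in (0 : ℝ)..1, sawDiff a t ^ 2 = Int.fract a - Int.fract a ^ 2 := by
  set τ := Int.fract a with hτ
  have h0 : 0 ≤ τ := Int.fract_nonneg a
  have h1 : τ < 1 := Int.fract_lt_one a
  have hS (t : ℝ) : sawDiff a t = Int.fract (t + τ) - Int.fract t := by
    rw [sawDiff, hτ, ← Int.self_sub_floor a, ← add_sub_assoc, Int.fract_sub_intCast]
  have hint (u v : ℝ) : IntervalIntegrable (fun t => sawDiff a t ^ 2) volume u v := by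
    refine intervalIntegrable_of_measurable_of_abs_le (M := 1)
      ((measurable_sawDiff a).pow_const 2) (fun t => ?_) _ _
    rw [abs_pow]
    exact pow_le_one₀ (abs_nonneg _) (abs_sawDiff_le a t)
  rw [← integral_add_adjacent_intervals (hint 0 (1 - τ)) (hint (1 - τ) 1)]
  have e1 : ∫ t in (0 : ℝ)..(1 - τ), sawDiff a t ^ 2 = ∫ t in (0 : ℝ)..(1 - τ), τ ^ 2 := by
    refine integral_congr_ae ?_
    have : ∀ᵐ t : ℝ, t ≠ 1 - τ := by simp [ae_iff, measure_singleton]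
    filter_upwards [this] with t ht hmem
    rw [Set.uIoc_of_le (by linarith)] at hmem
    have hlt : t < 1 - τ := lt_of_le_of_ne hmem.2 ht
    rw [hS, Int.fract_eq_self.mpr ⟨by linarith [hmem.1], by linarith⟩,
      Int.fract_eq_self.mpr ⟨hmem.1.le, by linarith⟩]
    ring
  have e2 : ∫ t in (1 - τ)..1, sawDiff a t ^ 2 = ∫ t in (1 - τ)..1, (τ - 1) ^ 2 := by
    refine integral_congr_ae ?_
    have : ∀ᵐ t : ℝ, t ≠ 1 := by simp [ae_iff, measure_singleton]
    filter_upwards [this] with t ht hmem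
    rw [Set.uIoc_of_le (by linarith)] at hmem
    have hlt : t < 1 := lt_of_le_of_ne hmem.2 ht
    have : Int.fract (t + τ) = t + τ - 1 := by
      rw [← Int.fract_sub_one, Int.fract_eq_self.mpr ⟨by linarith [hmem.1], by linarith⟩]
    rw [hS, this, Int.fract_eq_self.mpr ⟨by linarith [hmem.1], hlt⟩]
    ring
  rw [e1, e2, intervalIntegral.integral_const, intervalIntegral.integral_const]
  simp only [smul_eq_mul]
  ring

/-- Bessel's identity: the cross terms give `-∑ c_k²` and, by orthogonality, the square of the
partial sum gives `∑ c_k² / 2`. -/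
theorem integral_sawDiff_sub_sawPartial_sq (a : ℝ) (K : ℕ) :
    ∫ t in (0 : ℝ)..1, (sawDiff a t - sawPartial a K t) ^ 2 =
      Int.fract a - Int.fract a ^ 2 - ∑ k ∈ Icc 1 K, sawCoeff a k ^ 2 / 2 := by
  set c : ℕ → ℝ → ℝ := fun k t => Real.cos (2 * Real.pi * k * t + Real.pi * k * a) with hc
  have hcc (k : ℕ) : Continuous (c k) := by simp only [hc]; fun_prop
  have e (t : ℝ) : (sawDiff a t - sawPartial a K t) ^ 2 = sawDiff a t ^ 2 +
      (∑ k ∈ Icc 1 K, 2 * sawCoeff a k * (sawDiff a t * c k t)) +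
      ∑ k ∈ Icc 1 K, ∑ l ∈ Icc 1 K, sawCoeff a k * sawCoeff a l * (c k t * c l t) := by
    have h2 : ∑ k ∈ Icc 1 K, ∑ l ∈ Icc 1 K, sawCoeff a k * sawCoeff a l * (c k t * c l t) =
        (∑ k ∈ Icc 1 K, sawCoeff a k * c k t) * ∑ k ∈ Icc 1 K, sawCoeff a k * c k t := by
      rw [sum_mul_sum]
      exact sum_congr rfl fun k _ => sum_congr rfl fun l _ => by ring
    have h1 : ∑ k ∈ Icc 1 K, 2 * sawCoeff a k * (sawDiff a t * c k t) =
        2 * sawDiff a t * ∑ k ∈ Icc 1 K, sawCoeff a k * c k t := by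
      rw [mul_sum]
      exact sum_congr rfl fun k _ => by ring
    rw [h1, h2, sawPartial]
    ring
  have i1 : IntervalIntegrable (fun t => sawDiff a t ^ 2) volume 0 1 := by
    refine intervalIntegrable_of_measurable_of_abs_le (M := 1)
      ((measurable_sawDiff a).pow_const 2) (fun t => ?_) _ _
    rw [abs_pow]
    exact pow_le_one₀ (abs_nonneg _) (abs_sawDiff_le a t)
  have i2 (k : ℕ) : IntervalIntegrable (fun t => sawDiff a t * c k t) volume 0 1 := by
    refine intervalIntegrable_of_measurable_of_abs_le (M := 1)
      ((measurable_sawDiff a).mul (hcc k).measurable) (fun t => ?_) _ _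
    rw [Pi.mul_apply, abs_mul]
    exact mul_le_one₀ (abs_sawDiff_le a t) (abs_nonneg _) (Real.abs_cos_le_one _)
  have i3 (k l : ℕ) : IntervalIntegrable (fun t => c k t * c l t) volume 0 1 :=
    ((hcc k).mul (hcc l)).intervalIntegrable _ _
  have j2 : IntervalIntegrable (fun t => ∑ k ∈ Icc 1 K, 2 * sawCoeff a k * (sawDiff a t * c k t))
      volume 0 1 := by
    simpa only [sum_fn] using IntervalIntegrable.sum _ fun k _ => (i2 k).const_mul (2 * sawCoeff a k)
  have j3 : IntervalIntegrable (fun t => ∑ k ∈ Icc 1 K, ∑ l ∈ Icc 1 K,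
      sawCoeff a k * sawCoeff a l * (c k t * c l t)) volume 0 1 :=
    Continuous.intervalIntegrable (by fun_prop) _ _
  simp_rw [e]
  rw [intervalIntegral.integral_add (i1.add j2) j3, intervalIntegral.integral_add i1 j2,
    integral_sawDiff_sq, intervalIntegral.integral_finsetSum fun k _ =>
      (i2 k).const_mul (2 * sawCoeff a k), intervalIntegral.integral_finsetSum fun k _ =>
      Continuous.intervalIntegrable (by fun_prop) _ _]
  have e2 : ∑ k ∈ Icc 1 K, ∫ t in (0 : ℝ)..1, 2 * sawCoeff a k * (sawDiff a t * c k t) =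
      ∑ k ∈ Icc 1 K, -sawCoeff a k ^ 2 := by
    refine sum_congr rfl fun k hk => ?_
    rw [intervalIntegral.integral_const_mul,
      integral_sawDiff_mul_cos a (by have := (mem_Icc.mp hk).1; lia)]
    ring
  have e3 : ∑ k ∈ Icc 1 K, ∫ t in (0 : ℝ)..1, ∑ l ∈ Icc 1 K,
      sawCoeff a k * sawCoeff a l * (c k t * c l t) = ∑ k ∈ Icc 1 K, sawCoeff a k ^ 2 / 2 := by
    refine sum_congr rfl fun k hk => ?_
    rw [intervalIntegral.integral_finsetSum fun l _ => (i3 k l).const_mul _]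
    calc _ = ∑ l ∈ Icc 1 K, if k = l then sawCoeff a k ^ 2 / 2 else 0 := by
          refine sum_congr rfl fun l hl => ?_
          rw [intervalIntegral.integral_const_mul, hc,
            integral_cos_mul_cos (by have := (mem_Icc.mp hk).1; lia)
              (by have := (mem_Icc.mp hl).1; lia)]
          split_ifs with h
          · subst h; ring
          · ring
      _ = _ := by rw [sum_ite_eq, if_pos hk]
  rw [e2, e3, sum_neg_distrib]
  have : ∑ k ∈ Icc 1 K, sawCoeff a k ^ 2 = ∑ k ∈ Icc 1 K, sawCoeff a k ^ 2 / 2 +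
      ∑ k ∈ Icc 1 K, sawCoeff a k ^ 2 / 2 := by
    rw [← sum_add_distrib]; exact sum_congr rfl fun _ _ => by ring
  linarith

/-- Parseval for `sawDiff a`. As `2 sin² y = 1 - cos 2y`, the series is a difference of two values
of the Fourier series of the Bernoulli polynomial `X² - X + 1/6`, at `0` and at `{a}`. With Bessel's
identity this yields mean square convergence of the partial sums. -/
theorem hasSum_sawCoeff_sq (a : ℝ) :
    HasSum (fun k : ℕ => sawCoeff a k ^ 2 / 2) (Int.fract a - Int.fract a ^ 2) := by
  have h := hasSum_one_div_nat_pow_mul_cos one_ne_zero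
    (x := Int.fract a) ⟨Int.fract_nonneg a, (Int.fract_lt_one a).le⟩
  have h0 := hasSum_one_div_nat_pow_mul_cos one_ne_zero (x := 0) ⟨le_rfl, zero_le_one⟩
  have hB : Polynomial.map (algebraMap ℚ ℝ) (Polynomial.bernoulli (2 * 1)) =
      Polynomial.X ^ 2 - Polynomial.X + Polynomial.C (1 / 6) := by
    rw [show (2 * 1 : ℕ) = 2 by rfl, Polynomial.bernoulli_def]
    simp only [sum_range_succ, range_zero, sum_empty, Polynomial.map_add,
      ← Polynomial.C_mul_X_pow_eq_monomial]
    norm_num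
    ring
  rw [hB] at h h0
  have := (h0.sub h).div_const (Real.pi ^ 2)
  have hpi := Real.pi_ne_zero
  have hval : Int.fract a - Int.fract a ^ 2 = ((-1) ^ (1 + 1) * (2 * Real.pi) ^ (2 * 1) / 2 /
      (2 * 1).factorial * Polynomial.eval 0 (Polynomial.X ^ 2 - Polynomial.X + Polynomial.C (1 / 6)) -
      (-1) ^ (1 + 1) * (2 * Real.pi) ^ (2 * 1) / 2 / (2 * 1).factorial * Polynomial.eval
        (Int.fract a) (Polynomial.X ^ 2 - Polynomial.X + Polynomial.C (1 / 6))) / Real.pi ^ 2 := by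
    simp
    field_simp
    ring
  rw [hval]
  refine this.congr_fun fun k => ?_
  have hcos : Real.cos (2 * Real.pi * k * Int.fract a) = Real.cos (2 * Real.pi * k * a) := by
    rw [← Int.self_sub_floor, show 2 * Real.pi * (k : ℝ) * (a - ⌊a⌋) =
      2 * Real.pi * k * a - ((k * ⌊a⌋ : ℤ) : ℝ) * (2 * Real.pi) by push_cast; ring,
      Real.cos_sub_int_mul_two_pi]
  rw [hcos, show 2 * Real.pi * (k : ℝ) * a = 2 * (Real.pi * k * a) by ring, Real.cos_two_mul,
    sawCoeff, Real.cos_sq']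
  rcases eq_or_ne k 0 with rfl | hk
  · simp
  · simp only [mul_zero, Real.cos_zero]
    field_simp
    ring

theorem tendsto_sum_Icc_sawCoeff_sq (a : ℝ) :
    Tendsto (fun K => ∑ k ∈ Icc 1 K, sawCoeff a k ^ 2 / 2) atTop
      (𝓝 (Int.fract a - Int.fract a ^ 2)) := by
  refine ((hasSum_sawCoeff_sq a).tendsto_sum_nat.comp (tendsto_add_atTop_nat 1)).congr fun K => ?_
  simp only [Function.comp]
  rw [sum_range_eq_add_Ico _ (by lia)]
  have : sawCoeff a 0 = 0 := by simp [sawCoeff]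
  rw [this]
  simp [Finset.Ico_add_one_right_eq_Icc]

theorem tendsto_integral_sawDiff_sub_sawPartial_sq (a : ℝ) :
    Tendsto (fun K => ∫ t in (0 : ℝ)..1, (sawDiff a t - sawPartial a K t) ^ 2) atTop (𝓝 0) := by
  simp_rw [integral_sawDiff_sub_sawPartial_sq]
  have h := (tendsto_sum_Icc_sawCoeff_sq a).const_sub (Int.fract a - Int.fract a ^ 2)
  rwa [sub_self] at h

/-- After the substitution `t = x / d` the interval is covered by a fixed number `n` of periods. -/
theorem tendsto_integral_dilate_sq {d : ℝ} (hd : 0 < d) (a : ℝ) {u v : ℝ} (huv : u ≤ v) :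
    Tendsto (fun K => ∫ x in u..v, (sawDiff a (x / d) - sawPartial a K (x / d)) ^ 2) atTop
      (𝓝 0) := by
  set n : ℤ := ⌈v / d - u / d⌉ with hn
  have huv' : u / d ≤ v / d := by gcongr
  have hper (K : ℕ) : Function.Periodic (fun t => (sawDiff a t - sawPartial a K t) ^ 2) 1 := by
    intro t
    simp only [sawDiff_periodic a t, sawPartial_periodic a K t]
  have hint (K : ℕ) (p r : ℝ) :
      IntervalIntegrable (fun t => (sawDiff a t - sawPartial a K t) ^ 2) volume p r :=
    intervalIntegrable_sub_sq (measurable_sawDiff a) (abs_sawDiff_le a) (continuous_sawPartial a K)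
      p r
  refine squeeze_zero (fun K => integral_nonneg huv fun t _ => sq_nonneg _)
    (g := fun K => d * (n * ∫ t in (0 : ℝ)..1, (sawDiff a t - sawPartial a K t) ^ 2))
    (fun K => ?_) ?_
  · rw [integral_comp_div (fun t => (sawDiff a t - sawPartial a K t) ^ 2) hd.ne', smul_eq_mul]
    refine mul_le_mul_of_nonneg_left ?_ hd.le
    have e := (hper K).intervalIntegral_add_zsmul_eq n (u / d) (hint K)
    simp only [zsmul_eq_mul, mul_one, (hper K).intervalIntegral_add_eq (u / d) 0, zero_add] at e
    rw [← e]
    refine integral_mono_interval le_rfl huv' ?_ (Eventually.of_forall fun t => sq_nonneg _)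
      (hint K _ _)
    have := Int.le_ceil (v / d - u / d)
    linarith
  · simpa using ((tendsto_integral_sawDiff_sub_sawPartial_sq a).const_mul (n : ℝ)).const_mul d

theorem tendsto_integral_sq_of_tendsto {f : ℝ → ℝ} {g : ℕ → ℝ → ℝ} {a b M : ℝ} (hab : a ≤ b)
    (hf : Measurable f) (hM : ∀ x, |f x| ≤ M) (hg : ∀ K, Continuous (g K))
    (h : Tendsto (fun K => ∫ x in a..b, (f x - g K x) ^ 2) atTop (𝓝 0)) :
    Tendsto (fun K => ∫ x in a..b, g K x ^ 2) atTop (𝓝 (∫ x in a..b, f x ^ 2)) := by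
  have hM0 : 0 ≤ M := (abs_nonneg _).trans (hM 0)
  have if2 : IntervalIntegrable (fun x => f x ^ 2) volume a b := by
    refine intervalIntegrable_of_measurable_of_abs_le (M := M ^ 2) (hf.pow_const 2) (fun x => ?_) _ _
    rw [abs_pow]
    exact pow_le_pow_left₀ (abs_nonneg _) (hM x) 2
  have ig (K : ℕ) : IntervalIntegrable (fun x => g K x ^ 2) volume a b :=
    ((hg K).pow 2).intervalIntegrable _ _
  have id2 (K : ℕ) : IntervalIntegrable (fun x => (f x - g K x) ^ 2) volume a b :=
    intervalIntegrable_sub_sq hf hM (hg K) a b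
  set I : ℕ → ℝ := fun K => ∫ x in a..b, (f x - g K x) ^ 2 with hI
  have key (K : ℕ) (η : ℝ) (hη : 0 < η) :
      |(∫ x in a..b, g K x ^ 2) - ∫ x in a..b, f x ^ 2| ≤ η * (b - a) + (1 + M ^ 2 / η) * I K := by
    rw [← intervalIntegral.integral_sub (ig K) if2]
    have hrhs : η * (b - a) + (1 + M ^ 2 / η) * I K =
        ∫ x in a..b, (η + (1 + M ^ 2 / η) * (f x - g K x) ^ 2) := by
      rw [intervalIntegral.integral_add intervalIntegrable_const ((id2 K).const_mul _),
        intervalIntegral.integral_const, intervalIntegral.integral_const_mul, smul_eq_mul]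
      ring
    rw [hrhs, ← Real.norm_eq_abs]
    refine norm_integral_le_of_norm_le hab (Eventually.of_forall fun x _ => ?_)
      (intervalIntegrable_const.add ((id2 K).const_mul _))
    rw [Real.norm_eq_abs]
    set y := f x - g K x with hy
    have e : g K x ^ 2 - f x ^ 2 = y ^ 2 - 2 * (f x * y) := by rw [hy]; ring
    -- Young's inequality from `(η - M |y|)² ≥ 0`; it replaces Cauchy–Schwarz for integrals, `η`
    -- being chosen before `K`.
    have h1 : 2 * |f x * y| ≤ η + M ^ 2 / η * y ^ 2 := by
      rw [abs_mul]
      have h3 : |f x| * |y| ≤ M * |y| := mul_le_mul_of_nonneg_right (hM x) (abs_nonneg _)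
      have h4 : 0 ≤ (η - M * |y|) ^ 2 / η := by positivity
      have h5 : (η - M * |y|) ^ 2 / η = η - 2 * (M * |y|) + M ^ 2 / η * y ^ 2 := by
        rw [← sq_abs y]; field_simp; ring
      linarith
    rw [e]
    calc |y ^ 2 - 2 * (f x * y)| ≤ |y ^ 2| + |2 * (f x * y)| := abs_sub _ _
      _ = y ^ 2 + 2 * |f x * y| := by rw [abs_of_nonneg (sq_nonneg y), abs_mul, abs_two]
      _ ≤ _ := by linarith
  rw [Metric.tendsto_atTop]
  intro ε hε
  set η := ε / (2 * (b - a + 1)) with hη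
  have hb : 0 < b - a + 1 := by linarith
  have hη0 : 0 < η := by positivity
  have hc : 0 < 1 + M ^ 2 / η := by positivity
  obtain ⟨N, hN⟩ := (Metric.tendsto_atTop.mp h) (ε / (2 * (1 + M ^ 2 / η))) (by positivity)
  refine ⟨N, fun K hK => ?_⟩
  have h1 := hN K hK
  rw [Real.dist_eq, sub_zero] at h1
  rw [Real.dist_eq]
  refine (key K η hη0).trans_lt ?_
  have h2 : (1 + M ^ 2 / η) * I K < ε / 2 := by
    have := (le_abs_self _).trans_lt h1
    rw [lt_div_iff₀ (by positivity)] at this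
    simp only [hI]
    linarith
  have h3 : η * (b - a) ≤ ε / 2 := by
    rw [hη, div_mul_eq_mul_div, div_le_div_iff₀ (by positivity) (by norm_num)]
    nlinarith
  linarith

end TwistedTotient

/-! ### Mean square of sums of sawtooth differences -/

namespace TwistedTotient

open Finset Filter Topology MeasureTheory intervalIntegral

theorem abs_integral_cos_le {α : ℝ} (hα : α ≠ 0) (h u v : ℝ) :
    |∫ x in u..v, Real.cos (2 * Real.pi * α * (x + h))| ≤ 1 / |α| := by
  have hc : 2 * Real.pi * α ≠ 0 := by
    have := Real.pi_ne_zero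
    positivity
  have e (x : ℝ) : 2 * Real.pi * α * (x + h) = 2 * Real.pi * α * x + 2 * Real.pi * α * h := by ring
  simp_rw [e]
  rw [integral_comp_mul_add (fun t => Real.cos t) hc, integral_cos, smul_eq_mul, abs_mul, abs_inv,
    abs_mul, abs_of_pos Real.two_pi_pos]
  set A := Real.sin (2 * Real.pi * α * v + 2 * Real.pi * α * h)
  set B := Real.sin (2 * Real.pi * α * u + 2 * Real.pi * α * h)
  have h1 : |A - B| ≤ 2 := by
    have := abs_sub A B
    have := Real.abs_sin_le_one (2 * Real.pi * α * v + 2 * Real.pi * α * h)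
    have := Real.abs_sin_le_one (2 * Real.pi * α * u + 2 * Real.pi * α * h)
    linarith
  have h2 : 0 < |α| := abs_pos.mpr hα
  rw [inv_mul_le_iff₀ (by positivity)]
  calc |A - B| ≤ 2 := h1
    _ ≤ 2 * Real.pi := by linarith [Real.pi_gt_three]
    _ = _ := by field_simp

/-- The product of cosines splits into the frequencies `α - β` and `α + β`. For `α = β` the first is
constant and gives the main term, while the convention `1 / 0 = 0` drops it from the kernel. -/
theorem abs_integral_cos_mul_cos_sub_le {α β : ℝ} (hα : 0 < α) (hβ : 0 < β) (h u v : ℝ) :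
    |(∫ x in u..v, Real.cos (2 * Real.pi * α * (x + h)) * Real.cos (2 * Real.pi * β * (x + h))) -
      (if α = β then (v - u) / 2 else 0)| ≤ hilbertKernel α β := by
  have e (x : ℝ) : Real.cos (2 * Real.pi * α * (x + h)) * Real.cos (2 * Real.pi * β * (x + h)) =
      1 / 2 * (Real.cos (2 * Real.pi * (α - β) * (x + h)) +
        Real.cos (2 * Real.pi * (α + β) * (x + h))) := by
    have := Real.two_mul_cos_mul_cos (2 * Real.pi * α * (x + h)) (2 * Real.pi * β * (x + h))
    rw [show 2 * Real.pi * (α - β) * (x + h) = 2 * Real.pi * α * (x + h) -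
      2 * Real.pi * β * (x + h) by ring, show 2 * Real.pi * (α + β) * (x + h) =
      2 * Real.pi * α * (x + h) + 2 * Real.pi * β * (x + h) by ring]
    linarith
  simp_rw [e]
  rw [intervalIntegral.integral_const_mul, intervalIntegral.integral_add
    (Continuous.intervalIntegrable (by fun_prop) _ _)
    (Continuous.intervalIntegrable (by fun_prop) _ _), hilbertKernel]
  have hs := abs_integral_cos_le (show α + β ≠ 0 by positivity) h u v
  rw [abs_of_pos (show 0 < α + β by positivity)] at hs
  set J := ∫ x in u..v, Real.cos (2 * Real.pi * (α + β) * (x + h))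
  split_ifs with hab
  · subst hab
    simp only [sub_self, mul_zero, zero_mul, Real.cos_zero, intervalIntegral.integral_const,
      smul_eq_mul, mul_one, abs_zero, div_zero, zero_add]
    rw [show 1 / 2 * (v - u + J) - (v - u) / 2 = J / 2 by ring, abs_div, abs_two]
    linarith [abs_nonneg J]
  · have hd := abs_integral_cos_le (sub_ne_zero.mpr hab) h u v
    set I := ∫ x in u..v, Real.cos (2 * Real.pi * (α - β) * (x + h))
    rw [sub_zero, abs_mul, abs_of_pos (show (0 : ℝ) < 1 / 2 by norm_num)]
    have := abs_add_le I J
    linarith [abs_nonneg I, abs_nonneg J]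

/-- The mean square of a cosine polynomial over an interval, by the absolute off-diagonal sum. -/
theorem abs_integral_sum_cos_sq_sub_le {ι : Type*} (s : Finset ι) (A α : ι → ℝ)
    (hα : ∀ i ∈ s, 0 < α i) (h u v : ℝ) :
    |(∫ x in u..v, (∑ i ∈ s, A i * Real.cos (2 * Real.pi * α i * (x + h))) ^ 2) -
      (v - u) * ∑ i ∈ s, ∑ j ∈ s, (if α i = α j then A i * A j / 2 else 0)| ≤
      ∑ i ∈ s, ∑ j ∈ s, |A i| * |A j| * hilbertKernel (α i) (α j) := by
  have e (x : ℝ) : (∑ i ∈ s, A i * Real.cos (2 * Real.pi * α i * (x + h))) ^ 2 =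
      ∑ i ∈ s, ∑ j ∈ s, A i * A j * (Real.cos (2 * Real.pi * α i * (x + h)) *
        Real.cos (2 * Real.pi * α j * (x + h))) := by
    rw [sq, sum_mul_sum]
    exact sum_congr rfl fun _ _ => sum_congr rfl fun _ _ => by ring
  simp_rw [e]
  rw [intervalIntegral.integral_finsetSum fun i _ => Continuous.intervalIntegrable (by fun_prop) _ _,
    mul_sum, ← sum_sub_distrib]
  refine (abs_sum_le_sum_abs _ _).trans (sum_le_sum fun i hi => ?_)
  rw [intervalIntegral.integral_finsetSum fun i _ => Continuous.intervalIntegrable (by fun_prop) _ _,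
    mul_sum, ← sum_sub_distrib]
  refine (abs_sum_le_sum_abs _ _).trans (sum_le_sum fun j hj => ?_)
  rw [intervalIntegral.integral_const_mul]
  have := abs_integral_cos_mul_cos_sub_le (hα i hi) (hα j hj) h u v
  calc _ = |A i * A j * ((∫ x in u..v, Real.cos (2 * Real.pi * α i * (x + h)) *
        Real.cos (2 * Real.pi * α j * (x + h))) - (if α i = α j then (v - u) / 2 else 0))| := by
        congr 1; split_ifs <;> ring
    _ ≤ _ := by rw [abs_mul, abs_mul]; gcongr

/-- Interpolation between `|sin y| ≤ y` and `|sin y| ≤ 1`; the free exponent `σ` trades decay in `k`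
against growth in `a`. -/
theorem abs_sawCoeff_le {a σ : ℝ} (ha : 0 < a) (hσ0 : 0 ≤ σ) (hσ1 : σ ≤ 1) {k : ℕ} (hk : k ≠ 0) :
    |sawCoeff a k| ≤ 2 / k * (k * a) ^ σ := by
  have hk0 : (0 : ℝ) < k := by positivity
  set y : ℝ := k * a with hy
  have hy0 : 0 < y := by positivity
  have hpi := Real.pi_pos
  have h1 : |Real.sin (Real.pi * k * a)| ≤ Real.pi * y ^ σ := by
    rcases le_total y 1 with h | h
    · calc _ ≤ |Real.pi * k * a| := Real.abs_sin_le_abs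
        _ = Real.pi * y := by rw [abs_of_pos (by positivity), hy]; ring
        _ ≤ Real.pi * y ^ σ := by
            gcongr
            exact Real.self_le_rpow_of_le_one hy0.le h hσ1
    · calc _ ≤ 1 := Real.abs_sin_le_one _
        _ ≤ Real.pi * 1 := by linarith [Real.pi_gt_three]
        _ ≤ _ := by gcongr; exact Real.one_le_rpow h hσ0
  rw [sawCoeff, abs_div, abs_mul, abs_two, abs_of_pos (show 0 < Real.pi * k by positivity),
    div_le_iff₀ (by positivity)]
  calc _ ≤ 2 * (Real.pi * y ^ σ) := by gcongr
    _ = _ := by field_simp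

/-- The truncated error term, a combination of sawtooth differences. -/
noncomputable def sawSum (a : ℕ → ℝ) (H : ℝ) (D : ℕ) (x : ℝ) : ℝ :=
  ∑ d ∈ Icc 1 D, a d * sawDiff (H / d) (x / d)

/-- The mean value of `sawDiff (H / d) (x / d) * sawDiff (H / e) (x / e)`. -/
noncomputable def sawCorrelation (H : ℝ) (d e : ℕ) : ℝ :=
  (d.gcd e : ℝ) ^ 2 / (d * e) * (Int.fract (H / d.gcd e) - Int.fract (H / d.gcd e) ^ 2)

theorem sawCoeff_div (a : ℝ) (m d : ℕ) (hd : d ≠ 0) :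
    sawCoeff (a / d) (m * d) = sawCoeff a m / d := by
  rw [sawCoeff, sawCoeff]
  push_cast
  rw [show Real.pi * (m * d) * (a / d) = Real.pi * m * a by field_simp]
  field_simp

/-- Write `d = d' g` and `e = e' g` with `d', e'` coprime. Equal frequencies are exactly `(k, l) =
(m d', m e')`, where the coefficients are those of `H / g` at `m` divided by `d'` and by `e'`, so
Parseval for `H / g` gives the limit. -/
theorem tendsto_sum_sawCoeff_mul_sawCoeff (H : ℝ) {d e : ℕ} (hd : 0 < d) (he : 0 < e) :
    Tendsto (fun K : ℕ => ∑ k ∈ Icc 1 K, ∑ l ∈ Icc 1 K, if (k : ℝ) / d = (l : ℝ) / e then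
      sawCoeff (H / d) k * sawCoeff (H / e) l / 2 else 0) atTop (𝓝 (sawCorrelation H d e)) := by
  obtain ⟨g, d', e', hg, hcop, rfl, rfl⟩ := Nat.exists_coprime' (Nat.gcd_pos_of_pos_left e hd)
  have hgcd : (d' * g).gcd (e' * g) = g := by
    rw [Nat.gcd_mul_right, hcop.gcd_eq_one, one_mul]
  have hd' : 0 < d' := Nat.pos_of_mul_pos_right hd
  have he' : 0 < e' := Nat.pos_of_mul_pos_right he
  have hgR : (0 : ℝ) < g := by exact_mod_cast hg
  have hdR : (0 : ℝ) < d' := by exact_mod_cast hd'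
  have heR : (0 : ℝ) < e' := by exact_mod_cast he'
  -- Both `m d' ≤ K` and `m e' ≤ K` hold exactly when `m ≤ K / M`.
  set M := max d' e' with hM
  have hM0 : 0 < M := lt_max_of_lt_left hd'
  have hlim : Tendsto (fun K : ℕ => K / M) atTop atTop := Nat.tendsto_div_const_atTop hM0.ne'
  have h := ((tendsto_sum_Icc_sawCoeff_sq (H / g)).comp hlim).div_const ((d' : ℝ) * e')
  have hval : (Int.fract (H / g) - Int.fract (H / g) ^ 2) / ((d' : ℝ) * e') =
      sawCorrelation H (d' * g) (e' * g) := by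
    rw [sawCorrelation, hgcd]
    push_cast
    field_simp
  rw [hval] at h
  refine h.congr fun K => ?_
  rw [Function.comp, sum_div, ← sum_product']
  refine sum_of_injOn (fun m => (m * d', m * e')) ?_ ?_ ?_ ?_
  · intro m _ n _ hmn
    exact Nat.eq_of_mul_eq_mul_right hd' (Prod.mk.inj hmn).1
  · intro m hm
    simp only [coe_Icc, Set.mem_Icc] at hm
    have hle : m * M ≤ K := (Nat.le_div_iff_mul_le hM0).mp hm.2
    simp only [coe_product, Set.mem_prod, coe_Icc, Set.mem_Icc]
    have h1 : m * d' ≤ m * M := Nat.mul_le_mul_left _ (le_max_left _ _)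
    have h2 : m * e' ≤ m * M := Nat.mul_le_mul_left _ (le_max_right _ _)
    exact ⟨⟨Nat.mul_pos hm.1 hd', h1.trans hle⟩, ⟨Nat.mul_pos hm.1 he', h2.trans hle⟩⟩
  · rintro ⟨k, l⟩ hkl hnot
    simp only [mem_product, mem_Icc] at hkl
    refine if_neg fun heq => hnot ?_
    push_cast at heq
    have hnat : k * e' = l * d' := by
      have : (k : ℝ) * e' = l * d' := by
        field_simp at heq
        linarith
      exact_mod_cast this
    obtain ⟨m, rfl⟩ : d' ∣ k := hcop.dvd_of_dvd_mul_right ⟨l, by linarith⟩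
    have hl : l = m * e' := by
      refine Nat.eq_of_mul_eq_mul_right hd' ?_
      rw [← hnat]; ring
    subst hl
    refine ⟨m, ?_, by simp [mul_comm]⟩
    rw [coe_Icc, Set.mem_Icc, Nat.le_div_iff_mul_le hM0]
    refine ⟨Nat.pos_of_mul_pos_left hkl.1.1, ?_⟩
    rcases max_choice d' e' with hc | hc <;> rw [hM, hc]
    · rw [mul_comm]; exact hkl.1.2
    · exact hkl.2.2
  · intro m hm
    have hm0 : (0 : ℝ) < m := by exact_mod_cast (mem_Icc.mp hm).1
    push_cast
    rw [if_pos (by field_simp), show H / (d' * g : ℝ) = H / g / d' by field_simp,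
      show H / (e' * g : ℝ) = H / g / e' by field_simp, sawCoeff_div _ _ _ hd'.ne',
      sawCoeff_div _ _ _ he'.ne']
    field_simp

theorem measurable_sawSum (a : ℕ → ℝ) (H : ℝ) (D : ℕ) : Measurable (sawSum a H D) := by
  unfold sawSum
  exact Finset.measurable_fun_sum _ fun d _ =>
    ((measurable_sawDiff _).comp (measurable_id.div_const _)).const_mul _

theorem abs_sawSum_le (a : ℕ → ℝ) (H : ℝ) (D : ℕ) (x : ℝ) :
    |sawSum a H D x| ≤ ∑ d ∈ Icc 1 D, |a d| := by
  refine (abs_sum_le_sum_abs _ _).trans (sum_le_sum fun d _ => ?_)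
  rw [abs_mul]
  exact mul_le_of_le_one_right (abs_nonneg _) (abs_sawDiff_le _ _)

/-- `D` is fixed while `K → ∞`, so Cauchy–Schwarz over `d`, with a loss of a factor `D`, reduces
this to each `d` separately. -/
theorem tendsto_integral_sum_sawPartial_sq (a : ℕ → ℝ) (H : ℝ) (D : ℕ) {u v : ℝ} (huv : u ≤ v) :
    Tendsto (fun K => ∫ x in u..v, (∑ d ∈ Icc 1 D, a d * sawPartial (H / d) K (x / d)) ^ 2) atTop
      (𝓝 (∫ x in u..v, sawSum a H D x ^ 2)) := by
  have hcont (K : ℕ) (b : ℝ) (d : ℕ) : Continuous fun x => sawPartial b K (x / d) :=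
    (continuous_sawPartial b K).comp (continuous_id.div_const _)
  refine tendsto_integral_sq_of_tendsto huv (measurable_sawSum a H D) (abs_sawSum_le a H D)
    (fun K => continuous_finsetSum _ fun d _ => (hcont K _ d).const_mul (a d)) ?_
  have hint (K d : ℕ) : IntervalIntegrable
      (fun x => (sawDiff (H / d) (x / d) - sawPartial (H / d) K (x / d)) ^ 2) volume u v :=
    intervalIntegrable_sub_sq ((measurable_sawDiff _).comp (measurable_id.div_const _))
      (fun t => abs_sawDiff_le (H / d) (t / d)) (hcont K (H / d) d) u v
  refine squeeze_zero (fun K => integral_nonneg huv fun t _ => sq_nonneg _)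
    (g := fun K => ∑ d ∈ Icc 1 D, (D * a d ^ 2) *
      ∫ x in u..v, (sawDiff (H / d) (x / d) - sawPartial (H / d) K (x / d)) ^ 2) (fun K => ?_) ?_
  · simp_rw [← intervalIntegral.integral_const_mul]
    rw [← intervalIntegral.integral_finsetSum fun d _ => (hint K d).const_mul _]
    refine integral_mono_on_of_le_Ioo huv ?_ ?_ fun x _ => ?_
    · exact intervalIntegrable_sub_sq (measurable_sawSum a H D) (abs_sawSum_le a H D)
        (continuous_finsetSum _ fun d _ => (hcont K _ d).const_mul (a d)) u v
    · simpa only [sum_fn] using IntervalIntegrable.sum _ fun d _ => (hint K d).const_mul (D * a d ^ 2)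
    · rw [sawSum, ← sum_sub_distrib]
      refine sq_sum_le_card_mul_sum_sq.trans ?_
      rw [Nat.card_Icc, mul_sum]
      refine sum_le_sum fun d _ => le_of_eq ?_
      simp only [Nat.add_sub_cancel]
      ring
  · rw [← sum_const_zero (s := Icc 1 D)]
    refine tendsto_finsetSum _ fun d hd => ?_
    have hd0 : (0 : ℝ) < d := by exact_mod_cast (mem_Icc.mp hd).1
    simpa using (tendsto_integral_dilate_sq hd0 (H / d) huv).const_mul (D * a d ^ 2)

/-- The phase `π k H / d` is absorbed by the shift `x + H / 2`, the same for all `k` and `d`: the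
sum is a pure cosine polynomial in one shifted variable. -/
theorem sum_sawPartial_eq (a : ℕ → ℝ) (H : ℝ) (D K : ℕ) (x : ℝ) :
    ∑ d ∈ Icc 1 D, a d * sawPartial (H / d) K (x / d) =
      -∑ i ∈ Icc 1 K ×ˢ Icc 1 D, a i.2 * sawCoeff (H / i.2) i.1 *
        Real.cos (2 * Real.pi * (i.1 / i.2) * (x + H / 2)) := by
  rw [sum_product_right, ← sum_neg_distrib]
  refine sum_congr rfl fun d _ => ?_
  rw [sawPartial, mul_neg, mul_sum]
  congr 1
  refine sum_congr rfl fun k _ => ?_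
  dsimp only
  rw [show 2 * Real.pi * k * (x / d) + Real.pi * k * (H / d) =
    2 * Real.pi * (k / d) * (x + H / 2) by ring, mul_assoc (a d)]

theorem hilbertKernel_div {k l d e : ℝ} (hd : 0 < d) (he : 0 < e) :
    hilbertKernel (k / d) (l / e) = d * e * hilbertKernel (k * e) (l * d) := by
  rw [hilbertKernel, hilbertKernel, show k / d - l / e = (k * e - l * d) / (d * e) by field_simp,
    show k / d + l / e = (k * e + l * d) / (d * e) by field_simp, abs_div,
    abs_of_pos (show 0 < d * e by positivity), one_div_div, one_div_div]
  ring

theorem abs_mul_abs_mul_hilbertKernel_le {a : ℕ → ℝ} (ha : ∀ d, 0 < d → |a d| ≤ 1 / d)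
    {H η : ℝ} (hH : 1 ≤ H) (hη : 0 ≤ η) (hη4 : η ≤ 1 / 4) {D k l d e : ℕ} (hk : 0 < k) (hl : 0 < l)
    (hd : 0 < d) (he : 0 < e) (hdD : d ≤ D) (heD : e ≤ D) :
    |a d * sawCoeff (H / d) k| * |a e * sawCoeff (H / e) l| *
      hilbertKernel ((k : ℝ) / d) ((l : ℝ) / e) ≤ 4 * H * (D : ℝ) ^ (8 * η) *
      ((((k * e : ℕ) : ℝ) * (l * d : ℕ)) ^ (-(1 / 2) - 2 * η) *
        hilbertKernel (k * e : ℕ) (l * d : ℕ)) := by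
  have hk0 : (0 : ℝ) < k := by exact_mod_cast hk
  have hl0 : (0 : ℝ) < l := by exact_mod_cast hl
  have hd0 : (0 : ℝ) < d := by exact_mod_cast hd
  have he0 : (0 : ℝ) < e := by exact_mod_cast he
  have hdD' : (d : ℝ) ≤ D := by exact_mod_cast hdD
  have heD' : (e : ℝ) ≤ D := by exact_mod_cast heD
  have hH0 : 0 < H := by linarith
  -- With this `σ` the products `k e` and `l d` appear to the power `σ - 1 = -1/2 - 2 η`, the
  -- exponent of the off-diagonal sum; what remains is `H ^ (2 σ) ≤ H` and `(d e) ^ (1 - 2 σ) ≤ D ^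
  -- (8 η)`.
  set σ : ℝ := 1 / 2 - 2 * η with hσ
  have hσ0 : 0 ≤ σ := by linarith
  have hσ1 : σ ≤ 1 := by linarith
  rw [hilbertKernel_div hd0 he0]
  push_cast
  set R := hilbertKernel ((k : ℝ) * e) (l * d) with hR
  have hR0 : 0 ≤ R := hilbertKernel_nonneg (by positivity) (by positivity)
  have h1 := abs_sawCoeff_le (a := H / d) (by positivity) hσ0 hσ1 hk.ne'
  have h2 := abs_sawCoeff_le (a := H / e) (by positivity) hσ0 hσ1 hl.ne'
  rw [abs_mul, abs_mul]
  have hpow : ((k : ℝ) * (H / d)) ^ σ * ((l : ℝ) * (H / e)) ^ σ =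
      H ^ (2 * σ) * ((k : ℝ) * e * (l * d)) ^ σ * ((d : ℝ) * e) ^ (-(2 * σ)) := by
    rw [← Real.mul_rpow (by positivity) (by positivity), Real.rpow_neg (by positivity),
      Real.rpow_mul hH0.le, Real.rpow_mul (by positivity), ← Real.mul_rpow (by positivity)
      (by positivity), ← Real.inv_rpow (by positivity), ← Real.mul_rpow (by positivity)
      (by positivity)]
    congr 1
    simp only [Real.rpow_ofNat]
    field_simp
  have hfac : ((k : ℝ) * e * (l * d)) ^ (-(1 / 2) - 2 * η) =
      ((k : ℝ) * e * (l * d)) ^ σ * ((k : ℝ) * e * (l * d))⁻¹ := by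
    rw [← Real.rpow_neg_one, ← Real.rpow_add (by positivity)]
    congr 1; rw [hσ]; ring
  have hde : ((d : ℝ) * e) ^ (-(2 * σ)) * (d * e) ≤ (D : ℝ) ^ (8 * η) := by
    calc ((d : ℝ) * e) ^ (-(2 * σ)) * (d * e) = ((d : ℝ) * e) ^ (4 * η) := by
          conv_lhs => rw [← Real.rpow_one ((d : ℝ) * e)]
          rw [← Real.rpow_mul (by positivity), ← Real.rpow_add (by positivity)]
          congr 1; rw [hσ]; ring
      _ ≤ ((D : ℝ) * D) ^ (4 * η) := by gcongr
      _ = _ := by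
          rw [← sq, ← Real.rpow_natCast, ← Real.rpow_mul (by positivity)]
          congr 1; push_cast; ring
  have hHp : H ^ (2 * σ) ≤ H := by
    conv_rhs => rw [← Real.rpow_one H]
    exact Real.rpow_le_rpow_of_exponent_le hH (by linarith)
  calc _ ≤ (1 / d * (2 / k * (k * (H / d)) ^ σ)) * (1 / e * (2 / l * (l * (H / e)) ^ σ)) *
        (d * e * R) := by
        have := ha d hd
        have := ha e he
        gcongr
    _ = 4 / (k * l) * (((k : ℝ) * (H / d)) ^ σ * ((l : ℝ) * (H / e)) ^ σ) * R := by
        field_simp; ring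
    _ = 4 * H ^ (2 * σ) * (((d : ℝ) * e) ^ (-(2 * σ)) * (d * e)) *
        (((k : ℝ) * e * (l * d)) ^ (-(1 / 2) - 2 * η) * R) := by
        rw [hpow, hfac]; field_simp
    _ ≤ _ := by gcongr

/-- The mean square of the truncated error term: main term and error `O(H D ^ (8 η))`. -/
theorem exists_abs_integral_sawSum_sq_sub_le {η : ℝ} (hη : 0 < η) (hη4 : η ≤ 1 / 4) :
    ∃ C : ℝ, 0 ≤ C ∧ ∀ (a : ℕ → ℝ), (∀ d, 0 < d → |a d| ≤ 1 / d) → ∀ (H u v : ℝ) (D : ℕ),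
      1 ≤ H → u ≤ v →
      |(∫ x in u..v, sawSum a H D x ^ 2) - (v - u) * ∑ d ∈ Icc 1 D, ∑ e ∈ Icc 1 D,
        a d * a e * sawCorrelation H d e| ≤ C * (H * (D : ℝ) ^ (8 * η)) := by
  obtain ⟨C, hC, hbound⟩ := exists_sum_product_hilbertKernel_le hη
  refine ⟨4 * C, by positivity, fun a ha H u v D hH huv => ?_⟩
  set A : ℕ × ℕ → ℝ := fun i => a i.2 * sawCoeff (H / i.2) i.1 with hA
  set α : ℕ × ℕ → ℝ := fun i => (i.1 : ℝ) / i.2 with hα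
  have hlim1 := tendsto_integral_sum_sawPartial_sq a H D huv
  have hlim2 : Tendsto (fun K => ∑ i ∈ Icc 1 K ×ˢ Icc 1 D, ∑ j ∈ Icc 1 K ×ˢ Icc 1 D,
      (if α i = α j then A i * A j / 2 else 0)) atTop
      (𝓝 (∑ d ∈ Icc 1 D, ∑ e ∈ Icc 1 D, a d * a e * sawCorrelation H d e)) := by
    have h : Tendsto (fun K : ℕ => ∑ d ∈ Icc 1 D, ∑ e ∈ Icc 1 D, a d * a e * ∑ k ∈ Icc 1 K,
        ∑ l ∈ Icc 1 K, if (k : ℝ) / d = (l : ℝ) / e then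
        sawCoeff (H / d) k * sawCoeff (H / e) l / 2 else 0) atTop
        (𝓝 (∑ d ∈ Icc 1 D, ∑ e ∈ Icc 1 D, a d * a e * sawCorrelation H d e)) :=
      tendsto_finsetSum _ fun d hd => tendsto_finsetSum _ fun e he =>
        (tendsto_sum_sawCoeff_mul_sawCoeff H (mem_Icc.mp hd).1 (mem_Icc.mp he).1).const_mul _
    refine h.congr fun K => ?_
    rw [sum_product_right]
    refine sum_congr rfl fun d _ => ?_
    simp_rw [sum_product_right]
    rw [sum_comm]
    refine sum_congr rfl fun e _ => ?_
    rw [mul_sum]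
    refine sum_congr rfl fun k _ => ?_
    rw [mul_sum]
    refine sum_congr rfl fun l _ => ?_
    simp only [hA, hα]
    split_ifs <;> ring
  -- The bound for cosine polynomials is uniform in `K`, so it survives the limit.
  refine le_of_tendsto (hlim1.sub (hlim2.const_mul (v - u))).abs (Eventually.of_forall fun K => ?_)
  simp_rw [sum_sawPartial_eq, neg_sq]
  have hpos : ∀ i ∈ Icc 1 K ×ˢ Icc 1 D, 0 < α i := fun i hi => by
    simp only [mem_product, mem_Icc] at hi
    have h1 : (0 : ℝ) < i.1 := by exact_mod_cast hi.1.1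
    have h2 : (0 : ℝ) < i.2 := by exact_mod_cast hi.2.1
    simp only [hα]; positivity
  refine (abs_integral_sum_cos_sq_sub_le (Icc 1 K ×ˢ Icc 1 D) A α hpos (H / 2) u v).trans ?_
  set W : ℕ → ℕ → ℝ := fun m n => ((m : ℝ) * n) ^ (-(1 / 2) - 2 * η) * hilbertKernel m n with hW
  calc _ ≤ ∑ i ∈ Icc 1 K ×ˢ Icc 1 D, ∑ j ∈ Icc 1 K ×ˢ Icc 1 D,
        4 * H * (D : ℝ) ^ (8 * η) * W (i.1 * j.2) (j.1 * i.2) := by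
        refine sum_le_sum fun i hi => sum_le_sum fun j hj => ?_
        simp only [mem_product, mem_Icc] at hi hj
        exact abs_mul_abs_mul_hilbertKernel_le ha hH hη.le hη4 hi.1.1 hj.1.1 hi.2.1 hj.2.1
          hi.2.2 hj.2.2
    _ = 4 * H * (D : ℝ) ^ (8 * η) * ∑ i ∈ Icc 1 K ×ˢ Icc 1 D, ∑ j ∈ Icc 1 K ×ˢ Icc 1 D,
        W (i.1 * j.2) (j.1 * i.2) := by simp_rw [mul_sum]
    _ = 4 * H * (D : ℝ) ^ (8 * η) * ∑ i ∈ Icc 1 K ×ˢ Icc 1 D, ∑ j ∈ Icc 1 K ×ˢ Icc 1 D,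
        W (i.1 * i.2) (j.1 * j.2) := by
        -- Exchanging the names of `d` and `e` makes each argument of `W` a product over its own
        -- pair.
        congr 1
        simp_rw [sum_product]
        refine sum_congr rfl fun k _ => ?_
        calc _ = ∑ d ∈ Icc 1 D, ∑ e ∈ Icc 1 D, ∑ l ∈ Icc 1 K, W (k * e) (l * d) :=
              sum_congr rfl fun d _ => sum_comm
          _ = ∑ e ∈ Icc 1 D, ∑ d ∈ Icc 1 D, ∑ l ∈ Icc 1 K, W (k * e) (l * d) := sum_comm
          _ = _ := sum_congr rfl fun e _ => sum_comm
    _ ≤ 4 * H * (D : ℝ) ^ (8 * η) * C := by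
        gcongr
        exact hbound K D
    _ = _ := by ring

end TwistedTotient

/-! ### The constant `c(H)`: Euler product, double series and truncation -/

namespace TwistedTotient

open Finset Filter Topology

/-- The coefficients `μ(n) ψ(n) / n²` restricted to `n` coprime to `g`. -/
noncomputable def coprimeTerm {q : ℕ} (ψ : DirichletCharacter ℂ q) (g n : ℕ) : ℂ :=
  if n.Coprime g then (ArithmeticFunction.moebius n : ℂ) * ψ n / (n : ℂ) ^ 2 else 0

theorem abs_moebius_le_one_real (n : ℕ) : |(ArithmeticFunction.moebius n : ℝ)| ≤ 1 := by
  exact_mod_cast ArithmeticFunction.abs_moebius_le_one (n := n)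

theorem norm_moebius_le_one (n : ℕ) : ‖(ArithmeticFunction.moebius n : ℂ)‖ ≤ 1 := by
  rw [Complex.norm_intCast]
  exact abs_moebius_le_one_real n

theorem norm_coprimeTerm_le {q : ℕ} (ψ : DirichletCharacter ℂ q) (g n : ℕ) :
    ‖coprimeTerm ψ g n‖ ≤ 1 / (n : ℝ) ^ 2 := by
  unfold coprimeTerm
  split_ifs
  · rw [norm_div, norm_mul, norm_pow, Complex.norm_natCast]
    gcongr
    exact mul_le_one₀ (norm_moebius_le_one n) (norm_nonneg _) (ψ.norm_le_one n)
  · rw [norm_zero]; positivity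

theorem coprimeTerm_zero {q : ℕ} (ψ : DirichletCharacter ℂ q) (g : ℕ) :
    coprimeTerm ψ g 0 = 0 := by
  simp [coprimeTerm]

theorem coprimeTerm_mul {q : ℕ} (ψ : DirichletCharacter ℂ q) (g : ℕ) {m n : ℕ}
    (h : m.Coprime n) : coprimeTerm ψ g (m * n) = coprimeTerm ψ g m * coprimeTerm ψ g n := by
  unfold coprimeTerm
  rw [ArithmeticFunction.isMultiplicative_moebius.map_mul_of_coprime h]
  simp only [Nat.coprime_mul_iff_left, Nat.cast_mul, map_mul, Int.cast_mul]
  by_cases h1 : m.Coprime g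
  · by_cases h2 : n.Coprime g
    · rw [if_pos ⟨h1, h2⟩, if_pos h1, if_pos h2]
      ring
    · rw [if_neg fun h => h2 h.2, if_neg h2, mul_zero]
  · rw [if_neg fun h => h1 h.1, if_neg h1, zero_mul]

theorem exists_norm_card_divisors_mul_coprimeTerm_le {q : ℕ} (ψ : DirichletCharacter ℂ q) :
    ∃ C : ℝ, ∀ g n : ℕ,
      ‖(n.divisors.card : ℂ) * coprimeTerm ψ g n‖ ≤ C * (n : ℝ) ^ (-1 - 1 / 2 : ℝ) := by
  obtain ⟨C, hC, hdiv⟩ := exists_card_divisors_le_rpow (show (0 : ℝ) < 1 / 2 by norm_num)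
  refine ⟨C, fun g n => ?_⟩
  rcases eq_or_ne n 0 with rfl | hn
  · simp only [coprimeTerm_zero, mul_zero, norm_zero]; positivity
  have hn0 : (0 : ℝ) < n := by positivity
  rw [norm_mul, Complex.norm_natCast]
  calc _ ≤ (C * (n : ℝ) ^ (1 / 2 : ℝ)) * (1 / (n : ℝ) ^ 2) := by
        have := hdiv n hn
        have := norm_coprimeTerm_le ψ g n
        gcongr
    _ = _ := by
        rw [show 1 / (n : ℝ) ^ 2 = (n : ℝ) ^ (-2 : ℝ) by
          rw [Real.rpow_neg hn0.le, Real.rpow_ofNat, one_div], mul_assoc, ← Real.rpow_add hn0]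
        norm_num

theorem summable_norm_card_divisors_mul_coprimeTerm {q : ℕ} (ψ : DirichletCharacter ℂ q) (g : ℕ) :
    Summable fun n : ℕ => ‖(n.divisors.card : ℂ) * coprimeTerm ψ g n‖ := by
  obtain ⟨C, hC⟩ := exists_norm_card_divisors_mul_coprimeTerm_le ψ
  exact Summable.of_nonneg_of_le (fun n => norm_nonneg _) (hC g)
    ((summable_rpow_neg_one_sub (by norm_num)).mul_left C)

/-- The summand is multiplicative and supported on squarefree `n` coprime to `g`. Its value at a
prime `p ∤ g` is `-2 ψ(p) / p²`, as `p` has two divisors. -/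
theorem hasProd_eulerFactor {q : ℕ} (ψ : DirichletCharacter ℂ q) (g : ℕ) :
    HasProd (eulerFactor ψ g) (∑' n : ℕ, (n.divisors.card : ℂ) * coprimeTerm ψ g n) := by
  have h := EulerProduct.eulerProduct_hasProd
    (f := fun n : ℕ => (n.divisors.card : ℂ) * coprimeTerm ψ g n) (by simp [coprimeTerm])
    (fun {m n} hmn => by
      rw [coprimeTerm_mul ψ g hmn, hmn.card_divisors_mul]; push_cast; ring)
    (summable_norm_card_divisors_mul_coprimeTerm ψ g) (by simp)
  convert h using 1
  ext p
  have hp := p.prop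
  rw [tsum_eq_sum (s := range 2)]
  · simp only [sum_range_succ, range_zero, sum_empty, pow_zero, pow_one, zero_add, eulerFactor,
      coprimeTerm, hp.coprime_iff_not_dvd, ArithmeticFunction.moebius_apply_prime hp, hp.divisors,
      card_pair hp.one_lt.ne]
    by_cases hpg : (p : ℕ) ∣ g
    · simp [hpg]
    · simp [hpg]
      ring
  · intro e he
    have he2 : 2 ≤ e := not_lt.mp fun h => he (mem_range.mpr h)
    have h0 : ArithmeticFunction.moebius ((p : ℕ) ^ e) = 0 := by
      rw [ArithmeticFunction.moebius_apply_prime_pow hp (by lia), if_neg (show e ≠ 1 by lia)]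
    simp [coprimeTerm, h0]

/-- The Euler products are bounded uniformly in `d`, so the terms are `O(1 / d²)`. -/
theorem summable_constantTerm {q : ℕ} (ψ : DirichletCharacter ℂ q) (H : ℝ) :
    Summable (constantTerm ψ H) := by
  obtain ⟨C, hC⟩ := exists_norm_card_divisors_mul_coprimeTerm_le ψ
  have hz : Summable fun n : ℕ => C * (n : ℝ) ^ (-1 - 1 / 2 : ℝ) :=
    (summable_rpow_neg_one_sub (by norm_num)).mul_left C
  set B := ∑' n : ℕ, C * (n : ℝ) ^ (-1 - 1 / 2 : ℝ)
  have hB (g : ℕ) : ‖∏' p, eulerFactor ψ g p‖ ≤ B := by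
    rw [(hasProd_eulerFactor ψ g).tprod_eq]
    exact tsum_of_norm_bounded hz.hasSum (hC g)
  have hB0 : 0 ≤ B := (norm_nonneg _).trans (hB 0)
  refine Summable.of_norm_bounded
    ((Real.summable_one_div_nat_pow.mpr one_lt_two).mul_right B) fun d => ?_
  rw [constantTerm]
  split_ifs
  · rw [norm_mul, norm_mul, norm_div, norm_pow, norm_pow, Complex.norm_natCast, Complex.norm_real,
      Real.norm_eq_abs]
    have h0 := Int.fract_nonneg (H / d)
    have h1 := (Int.fract_lt_one (H / d)).le
    have h2 : |Int.fract (H / d) - Int.fract (H / d) ^ 2| ≤ 1 := by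
      rw [abs_le]; constructor <;> nlinarith
    have h3 : ‖(ArithmeticFunction.moebius d : ℂ)‖ ^ 2 ≤ 1 :=
      pow_le_one₀ (norm_nonneg _) (norm_moebius_le_one d)
    calc _ ≤ 1 / (d : ℝ) ^ 2 * B * 1 := by
          have := hB d
          gcongr
      _ = _ := mul_one _
  · rw [norm_zero]; positivity

/-- Grouping the pairs by their product `n` brings out the number of divisors of `n`. The fibre over
`0` is infinite, but its terms vanish. -/
theorem hasSum_coprimeTerm_mul {q : ℕ} (ψ : DirichletCharacter ℂ q) (g : ℕ) :
    HasSum (fun p : ℕ × ℕ => coprimeTerm ψ g (p.1 * p.2)) (∏' p, eulerFactor ψ g p) := by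
  have hs : Summable fun p : ℕ × ℕ => coprimeTerm ψ g (p.1 * p.2) := by
    have h2 : Summable fun n : ℕ => 1 / (n : ℝ) ^ 2 :=
      Real.summable_one_div_nat_pow.mpr (by norm_num)
    refine Summable.of_norm_bounded (h2.mul_of_nonneg h2 (fun _ => by positivity)
      fun _ => by positivity) fun p => ?_
    refine (norm_coprimeTerm_le ψ g _).trans (le_of_eq ?_)
    push_cast
    ring
  have hf := hs.hasSum.tsum_fiberwise fun p : ℕ × ℕ => p.1 * p.2
  have e (n : ℕ) : ∑' b : (fun p : ℕ × ℕ => p.1 * p.2) ⁻¹' {n},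
      coprimeTerm ψ g (b.val.1 * b.val.2) = (n.divisors.card : ℂ) * coprimeTerm ψ g n := by
    have h1 (b : (fun p : ℕ × ℕ => p.1 * p.2) ⁻¹' {n}) :
        coprimeTerm ψ g (b.val.1 * b.val.2) = coprimeTerm ψ g n := by
      have : b.val.1 * b.val.2 = n := b.prop
      rw [this]
    simp_rw [h1]
    rcases eq_or_ne n 0 with rfl | hn
    · simp [coprimeTerm_zero]
    have h2 : (fun p : ℕ × ℕ => p.1 * p.2) ⁻¹' {n} = (n.divisorsAntidiagonal : Set (ℕ × ℕ)) := by
      ext p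
      simp [Nat.mem_divisorsAntidiagonal, hn]
    rw [h2, Finset.tsum_subtype' n.divisorsAntidiagonal (fun _ => coprimeTerm ψ g n), sum_const,
      nsmul_eq_mul, ← Nat.map_div_right_divisors, card_map]
  simp_rw [e] at hf
  rw [(hasProd_eulerFactor ψ g).tprod_eq, hf.tsum_eq]
  exact hs.hasSum

theorem moebius_mul_eq (g n : ℕ) : (ArithmeticFunction.moebius (g * n) : ℂ) =
    if n.Coprime g then (ArithmeticFunction.moebius g : ℂ) * ArithmeticFunction.moebius n
    else 0 := by
  split_ifs with h
  · rw [ArithmeticFunction.isMultiplicative_moebius.map_mul_of_coprime h.symm]; push_cast; ring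
  · rw [ArithmeticFunction.moebius_eq_zero_of_not_squarefree, Int.cast_zero]
    intro hsq
    exact h (Nat.squarefree_mul_iff.mp hsq).1.symm

theorem coprimeTerm_mul_of_not_coprime {q : ℕ} (ψ : DirichletCharacter ℂ q) (g : ℕ) {m n : ℕ}
    (h : ¬m.Coprime n) : coprimeTerm ψ g (m * n) = 0 := by
  unfold coprimeTerm
  rw [moebius_mul_eq m n, if_neg (show ¬n.Coprime m from fun h' => h h'.symm)]
  simp

theorem sq_eq_of_real {q : ℕ} {ψ : DirichletCharacter ℂ q} (hreal : ∀ a : ZMod q, (ψ a).im = 0)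
    (n : ℕ) : ψ n ^ 2 = if n.Coprime q then 1 else 0 := by
  split_ifs with h
  · have hu : IsUnit (n : ZMod q) := (ZMod.isUnit_iff_coprime n q).mpr h
    have hn : ‖ψ n‖ = 1 := by
      obtain ⟨u, hu⟩ := hu
      rw [← hu]
      exact ψ.unit_norm_eq_one u
    have hre : ψ n = ((ψ n).re : ℂ) := Complex.ext (by simp) (by simp [hreal])
    rw [hre, Complex.norm_real, Real.norm_eq_abs] at hn
    rw [hre, ← Complex.ofReal_pow, ← sq_abs, hn]
    norm_num
  · have : ¬IsUnit (n : ZMod q) := fun hu => h ((ZMod.isUnit_iff_coprime n q).mp hu)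
    rw [ψ.map_nonunit this]
    norm_num

/-- The general term of the double series for the mean square. -/
noncomputable def doubleTerm {q : ℕ} (ψ : DirichletCharacter ℂ q) (H : ℝ) (p : ℕ × ℕ) : ℂ :=
  (ArithmeticFunction.moebius p.1 : ℂ) * ψ p.1 / p.1 *
    ((ArithmeticFunction.moebius p.2 : ℂ) * ψ p.2 / p.2) * (sawCorrelation H p.1 p.2 : ℂ)

/-- The factors `μ(g a)` and `μ(g b)` force `a` and `b` to be coprime to `g`, and `ψ(g)²` is the
indicator of `(g, q) = 1` for a real character. All dependence on `H` stays with `g`. -/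
theorem doubleTerm_mul_mul {q : ℕ} {ψ : DirichletCharacter ℂ q}
    (hreal : ∀ a : ZMod q, (ψ a).im = 0) (H : ℝ) {g : ℕ} (hg : 0 < g) {a b : ℕ}
    (hab : a.Coprime b) : doubleTerm ψ H (g * a, g * b) =
    (if g.Coprime q then (ArithmeticFunction.moebius g : ℂ) ^ 2 / (g : ℂ) ^ 2 *
      ((Int.fract (H / g) - Int.fract (H / g) ^ 2 : ℝ) : ℂ) else 0) * coprimeTerm ψ g (a * b) := by
  have hgcd : (g * a).gcd (g * b) = g := by rw [Nat.gcd_mul_left, hab.gcd_eq_one, mul_one]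
  have hgC : (g : ℂ) ≠ 0 := by exact_mod_cast hg.ne'
  have hif : (if g.Coprime q then (ArithmeticFunction.moebius g : ℂ) ^ 2 / (g : ℂ) ^ 2 *
      ((Int.fract (H / g) - Int.fract (H / g) ^ 2 : ℝ) : ℂ) else 0) =
      (ArithmeticFunction.moebius g : ℂ) ^ 2 / (g : ℂ) ^ 2 *
      ((Int.fract (H / g) - Int.fract (H / g) ^ 2 : ℝ) : ℂ) * ψ g ^ 2 := by
    rw [sq_eq_of_real hreal]; split_ifs <;> simp
  rw [hif, coprimeTerm_mul ψ g hab, doubleTerm, sawCorrelation]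
  simp only [hgcd, moebius_mul_eq, coprimeTerm]
  set F := Int.fract (H / g) - Int.fract (H / g) ^ 2
  rcases eq_or_ne a 0 with rfl | ha
  · simp
  rcases eq_or_ne b 0 with rfl | hb
  · simp
  have haC : (a : ℂ) ≠ 0 := by exact_mod_cast ha
  have hbC : (b : ℂ) ≠ 0 := by exact_mod_cast hb
  split_ifs <;> simp
  field_simp

/-- Pairs are parametrised by `(g, a, b)` with `g > 0` the gcd and `a, b` coprime. In the inner sum
the coprimality of `a` and `b` can be dropped, since `coprimeTerm ψ g (a * b)` vanishes otherwise.
-/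
theorem hasSum_constantTerm {q : ℕ} {ψ : DirichletCharacter ℂ q}
    (hreal : ∀ a : ZMod q, (ψ a).im = 0) {H : ℝ} (hs : Summable (doubleTerm ψ H)) :
    HasSum (constantTerm ψ H) (∑' p, doubleTerm ψ H p) := by
  set Q : Set (ℕ × (ℕ × ℕ)) := {t | 0 < t.1 ∧ t.2.1.Coprime t.2.2} with hQ
  set φ : Q → ℕ × ℕ := fun t => (t.val.1 * t.val.2.1, t.val.1 * t.val.2.2) with hφ
  have hinj : Function.Injective φ := by
    rintro ⟨⟨g, a, b⟩, hg, hab⟩ ⟨⟨g', a', b'⟩, hg', hab'⟩ h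
    simp only [hφ, Prod.mk.injEq] at h
    dsimp only at hg hab hg' hab'
    have hgg : g = g' := by
      have h1 : (g * a).gcd (g * b) = g := by rw [Nat.gcd_mul_left, hab.gcd_eq_one, mul_one]
      have h2 : (g' * a').gcd (g' * b') = g' := by
        rw [Nat.gcd_mul_left, hab'.gcd_eq_one, mul_one]
      rw [← h1, ← h2, h.1, h.2]
    subst hgg
    have h1 := Nat.eq_of_mul_eq_mul_left hg h.1
    have h2 := Nat.eq_of_mul_eq_mul_left hg h.2
    subst h1 h2
    rfl
  have hrange : ∀ p ∉ Set.range φ, doubleTerm ψ H p = 0 := by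
    rintro ⟨d, e⟩ hp
    rcases Nat.eq_zero_or_pos d with rfl | hd
    · simp [doubleTerm]
    exfalso
    obtain ⟨g, a, b, hg, hab, h1, h2⟩ := Nat.exists_coprime' (Nat.gcd_pos_of_pos_left e hd)
    exact hp ⟨⟨(g, a, b), hg, hab⟩, by simp only [hφ]; rw [h1, h2, mul_comm g, mul_comm g]⟩
  have h1 := (hinj.hasSum_iff hrange).mpr hs.hasSum
  set U : ℕ × (ℕ × ℕ) → ℂ := Q.indicator fun t => doubleTerm ψ H (t.1 * t.2.1, t.1 * t.2.2) with hU
  have h2 : HasSum U (∑' p, doubleTerm ψ H p) := hasSum_subtype_iff_indicator.mp h1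
  refine h2.prod_fiberwise fun g => ?_
  rcases Nat.eq_zero_or_pos g with rfl | hg
  · have e1 : (fun c => U (0, c)) = 0 := by
      ext c
      simp [hU, hQ]
    have e2 : constantTerm ψ H 0 = 0 := by simp [constantTerm]
    rw [e1, e2]
    exact hasSum_zero
  · have h3 := (hasSum_coprimeTerm_mul ψ g).mul_left
      (if g.Coprime q then (ArithmeticFunction.moebius g : ℂ) ^ 2 / (g : ℂ) ^ 2 *
        ((Int.fract (H / g) - Int.fract (H / g) ^ 2 : ℝ) : ℂ) else 0)
    have e2 : (if g.Coprime q then (ArithmeticFunction.moebius g : ℂ) ^ 2 / (g : ℂ) ^ 2 *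
        ((Int.fract (H / g) - Int.fract (H / g) ^ 2 : ℝ) : ℂ) else 0) * ∏' p, eulerFactor ψ g p =
        constantTerm ψ H g := by
      rw [constantTerm]
      split_ifs
      · ring
      · rw [zero_mul]
    rw [e2] at h3
    refine h3.congr_fun fun c => ?_
    by_cases hc : c.1.Coprime c.2
    · rw [hU, Set.indicator_of_mem (show (g, c) ∈ Q from ⟨hg, hc⟩), doubleTerm_mul_mul hreal H hg hc]
    · rw [hU, Set.indicator_of_notMem (show (g, c) ∉ Q from fun h => hc h.2),
        coprimeTerm_mul_of_not_coprime ψ g hc, mul_zero]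

/-- The coefficients `μ(d) ψ(d) / d` of the twisted totient, for a real character. -/
noncomputable def divisorCoeff {q : ℕ} (ψ : DirichletCharacter ℂ q) (d : ℕ) : ℝ :=
  ArithmeticFunction.moebius d * (ψ d).re / d

theorem ofReal_divisorCoeff {q : ℕ} {ψ : DirichletCharacter ℂ q}
    (hreal : ∀ a : ZMod q, (ψ a).im = 0) (d : ℕ) :
    (divisorCoeff ψ d : ℂ) = ArithmeticFunction.moebius d * ψ d / d := by
  have hre : ψ d = ((ψ d).re : ℂ) := Complex.ext (by simp) (by simp [hreal])
  rw [hre, divisorCoeff]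
  push_cast
  simp

theorem abs_divisorCoeff_le {q : ℕ} (ψ : DirichletCharacter ℂ q) (d : ℕ) :
    |divisorCoeff ψ d| ≤ 1 / d := by
  rw [divisorCoeff, abs_div, abs_mul, Nat.abs_cast]
  gcongr
  exact mul_le_one₀ (abs_moebius_le_one_real d) (abs_nonneg _)
    ((Complex.abs_re_le_norm _).trans (ψ.norm_le_one _))

theorem ofReal_doubleTerm {q : ℕ} {ψ : DirichletCharacter ℂ q}
    (hreal : ∀ a : ZMod q, (ψ a).im = 0) (H : ℝ) (p : ℕ × ℕ) :
    doubleTerm ψ H p =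
      ((divisorCoeff ψ p.1 * divisorCoeff ψ p.2 * sawCorrelation H p.1 p.2 : ℝ) : ℂ) := by
  rw [doubleTerm]
  push_cast
  rw [ofReal_divisorCoeff hreal, ofReal_divisorCoeff hreal]

/-- Using `{y} - {y}² ≤ y` with `y = H / g` exchanges one factor `g` for `H`. -/
theorem abs_sawCorrelation_le {H : ℝ} (hH : 0 ≤ H) (d e : ℕ) :
    |sawCorrelation H d e| ≤ H * (d.gcd e : ℝ) / (d * e) := by
  rw [sawCorrelation, abs_mul, abs_of_nonneg (by positivity)]
  set g := d.gcd e
  rcases Nat.eq_zero_or_pos g with hg | hg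
  · simp [hg]
  have hg0 : (0 : ℝ) < g := by exact_mod_cast hg
  have h0 := Int.fract_nonneg (H / g)
  have h1 := (Int.fract_lt_one (H / g)).le
  have h2 : Int.fract (H / g) ≤ H / g := by
    have : (0 : ℝ) ≤ ⌊H / g⌋ := by exact_mod_cast Int.floor_nonneg.mpr (by positivity)
    rw [← Int.self_sub_floor]
    linarith
  have h3 : |Int.fract (H / g) - Int.fract (H / g) ^ 2| ≤ H / g := by
    rw [abs_of_nonneg (by nlinarith)]
    nlinarith
  calc _ ≤ (g : ℝ) ^ 2 / (d * e) * (H / g) := by gcongr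
    _ = _ := by field_simp

/-- With `m` and `M` the minimum and maximum of `d, e`, the gcd is at most `m ≤ m ^ (1 - η) M ^ η`,
and `d e = m M`. The power of `M` set aside gives the saving when `max d e ≥ D`; the rest is
summable. -/
theorem norm_doubleTerm_le {q : ℕ} {ψ : DirichletCharacter ℂ q}
    (hreal : ∀ a : ZMod q, (ψ a).im = 0) {H η : ℝ} (hH : 0 ≤ H) (hη : 0 ≤ η)
    {d e : ℕ} (hd : 0 < d) (he : 0 < e) :
    ‖doubleTerm ψ H (d, e)‖ ≤ H * ((max d e : ℕ) : ℝ) ^ (-1 + 2 * η) *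
      ((d : ℝ) ^ (-1 - η) * (e : ℝ) ^ (-1 - η)) := by
  have hd0 : (0 : ℝ) < d := by exact_mod_cast hd
  have he0 : (0 : ℝ) < e := by exact_mod_cast he
  set m : ℝ := ((min d e : ℕ) : ℝ) with hm
  set M : ℝ := ((max d e : ℕ) : ℝ) with hM
  have hm0 : 0 < m := by rw [hm]; exact_mod_cast lt_min hd he
  have hM0 : 0 < M := by rw [hM]; exact_mod_cast lt_max_of_lt_left hd
  have hmM : m ≤ M := by rw [hm, hM]; exact_mod_cast min_le_max
  have hprod : (d : ℝ) * e = m * M := by rw [hm, hM]; exact_mod_cast (min_mul_max d e).symm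
  have hg : (d.gcd e : ℝ) ≤ m := by
    rw [hm]; exact_mod_cast le_min (Nat.gcd_le_left e hd) (Nat.gcd_le_right d he)
  have hg2 : m ≤ m ^ (1 - η) * M ^ η := by
    calc m = m ^ (1 - η) * m ^ η := by rw [← Real.rpow_add hm0]; simp
      _ ≤ _ := by gcongr
  rw [ofReal_doubleTerm hreal, Complex.norm_real, Real.norm_eq_abs, abs_mul, abs_mul]
  calc _ ≤ 1 / d * (1 / e) * (H * (m ^ (1 - η) * M ^ η) / (d * e)) := by
        have h1 := abs_divisorCoeff_le ψ d
        have h2 := abs_divisorCoeff_le ψ e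
        have h3 := abs_sawCorrelation_le hH d e
        have h4 := hg.trans hg2
        refine mul_le_mul (mul_le_mul h1 h2 (abs_nonneg _) (by positivity)) (h3.trans ?_)
          (abs_nonneg _) (by positivity)
        gcongr
    _ = H * (m ^ (1 - η) * M ^ η) * ((m * M) ^ (-2 : ℝ)) := by
        rw [Real.rpow_neg (by positivity), Real.rpow_ofNat, ← hprod]
        field_simp
    _ = _ := by
        rw [← Real.mul_rpow hd0.le he0.le, hprod, Real.mul_rpow hm0.le hM0.le,
          Real.mul_rpow hm0.le hM0.le]
        calc _ = H * ((m ^ (1 - η) * m ^ (-2 : ℝ)) * (M ^ η * M ^ (-2 : ℝ))) := by ring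
          _ = H * (m ^ (-1 - η) * (M ^ (-1 + 2 * η) * M ^ (-1 - η))) := by
              rw [← Real.rpow_add hm0, ← Real.rpow_add hM0, ← Real.rpow_add hM0]
              congr 3 <;> ring
          _ = _ := by ring

theorem summable_rpow_mul_rpow {η : ℝ} (hη : 0 < η) :
    Summable fun p : ℕ × ℕ => (p.1 : ℝ) ^ (-1 - η) * (p.2 : ℝ) ^ (-1 - η) :=
  (summable_rpow_neg_one_sub hη).mul_of_nonneg (summable_rpow_neg_one_sub hη)
    (fun _ => by positivity) fun _ => by positivity

theorem doubleTerm_eq_zero {q : ℕ} (ψ : DirichletCharacter ℂ q) (H : ℝ) {p : ℕ × ℕ}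
    (hp : p.1 = 0 ∨ p.2 = 0) : doubleTerm ψ H p = 0 := by
  rcases hp with h | h <;> simp [doubleTerm, h]

theorem summable_doubleTerm {q : ℕ} {ψ : DirichletCharacter ℂ q}
    (hreal : ∀ a : ZMod q, (ψ a).im = 0) {H : ℝ} (hH : 0 ≤ H) : Summable (doubleTerm ψ H) := by
  -- For `η = 1/2` the power of the maximum disappears.
  have hη : (0 : ℝ) < 1 / 2 := by norm_num
  refine Summable.of_norm_bounded ((summable_rpow_mul_rpow hη).mul_left H) fun p => ?_
  by_cases hp : p.1 = 0 ∨ p.2 = 0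
  · rw [doubleTerm_eq_zero ψ H hp, norm_zero]; positivity
  push Not at hp
  have := norm_doubleTerm_le hreal hH hη.le (Nat.pos_of_ne_zero hp.1)
    (Nat.pos_of_ne_zero hp.2)
  norm_num at this ⊢
  exact this

theorem abs_sum_doubleTerm_sub_tsum_le {q : ℕ} {ψ : DirichletCharacter ℂ q}
    (hreal : ∀ a : ZMod q, (ψ a).im = 0) {H η : ℝ} (hH : 0 ≤ H) (hη : 0 < η) (hη2 : η ≤ 1 / 2)
    {D : ℕ} (hD : 0 < D) :
    ‖∑ p ∈ Icc 1 D ×ˢ Icc 1 D, doubleTerm ψ H p - ∑' p, doubleTerm ψ H p‖ ≤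
      H * (D : ℝ) ^ (-1 + 2 * η) * zetaValue η ^ 2 := by
  have hs := summable_doubleTerm hreal hH
  set B := Icc 1 D ×ˢ Icc 1 D with hB
  have hD0 : (0 : ℝ) < D := by exact_mod_cast hD
  set w : ℕ × ℕ → ℝ := fun p => (p.1 : ℝ) ^ (-1 - η) * (p.2 : ℝ) ^ (-1 - η) with hw
  have hwsum : HasSum (fun p => H * (D : ℝ) ^ (-1 + 2 * η) * w p)
      (H * (D : ℝ) ^ (-1 + 2 * η) * zetaValue η ^ 2) := by
    have := (summable_rpow_neg_one_sub hη).hasSum.mul (summable_rpow_neg_one_sub hη).hasSum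
      (summable_rpow_mul_rpow hη)
    rw [sq]
    exact this.mul_left _
  rw [← hs.sum_add_tsum_compl (s := B), sub_add_cancel_left, norm_neg,
    tsum_subtype ((B : Set (ℕ × ℕ))ᶜ) (doubleTerm ψ H)]
  refine tsum_of_norm_bounded hwsum fun p => ?_
  by_cases hpB : p ∈ B
  · rw [Set.indicator_of_notMem (by simpa using hpB), norm_zero]
    positivity
  rw [Set.indicator_of_mem (by simpa using hpB)]
  by_cases hp : p.1 = 0 ∨ p.2 = 0
  · rw [doubleTerm_eq_zero ψ H hp, norm_zero]; positivity
  push Not at hp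
  refine (norm_doubleTerm_le hreal hH hη.le (Nat.pos_of_ne_zero hp.1)
    (Nat.pos_of_ne_zero hp.2)).trans ?_
  have hmax : D ≤ max p.1 p.2 := by
    by_contra hlt
    push Not at hlt
    refine hpB ?_
    rw [hB, mem_product, mem_Icc, mem_Icc]
    lia
  have hmax' : (D : ℝ) ≤ ((max p.1 p.2 : ℕ) : ℝ) := by exact_mod_cast hmax
  have := Real.rpow_le_rpow_of_nonpos hD0 hmax' (show -1 + 2 * η ≤ 0 by linarith)
  gcongr

end TwistedTotient

/-! ### Reduction of the variance to sawtooth sums, and assembly of the error terms -/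

namespace TwistedTotient

open Finset Filter Topology MeasureTheory

/-- Both sides are unchanged when `n` is replaced by its radical: the product sees only the primes,
and `μ` kills the other divisors. For squarefree `n` the product expands directly. -/
theorem totient_div_eq_sum_divisors {q : ℕ} (ψ : DirichletCharacter ℂ q) {n : ℕ} (hn : n ≠ 0) :
    totient ψ n / n = ∑ d ∈ n.divisors, (ArithmeticFunction.moebius d : ℂ) * ψ d / d := by
  have hnC : (n : ℂ) ≠ 0 := by exact_mod_cast hn
  set f : ArithmeticFunction ℂ := ⟨fun n => ψ n / n, by simp⟩ with hf
  have hfa (n : ℕ) : f n = ψ n / n := rfl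
  have hmul : f.IsMultiplicative := by
    refine ArithmeticFunction.IsMultiplicative.iff_ne_zero.mpr ⟨by simp [hfa], ?_⟩
    intro m n _ _ _
    simp only [hfa, Nat.cast_mul, map_mul, mul_div_mul_comm]
  set r := UniqueFactorizationMonoid.radical n with hr
  have hsq : Squarefree r := UniqueFactorizationMonoid.squarefree_radical
  have hdvd : r ∣ n := UniqueFactorizationMonoid.radical_dvd_self
  have hpf : r.primeFactors = n.primeFactors := by
    rw [← UniqueFactorizationMonoid.primeFactors_eq_natPrimeFactors, hr,
      UniqueFactorizationMonoid.primeFactors_radical]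
  rw [totient, mul_div_cancel_left₀ _ hnC, ← hpf]
  have h := hmul.prodPrimeFactors_one_sub_of_squarefree f hsq
  simp only [hfa] at h
  rw [h]
  calc _ = ∑ d ∈ r.divisors, (ArithmeticFunction.moebius d : ℂ) * ψ d / d :=
        sum_congr rfl fun d _ => by rw [mul_div_assoc]
    _ = _ := by
        refine sum_subset (Nat.divisors_subset_of_dvd hn hdvd) fun d hd hdr => ?_
        rw [ArithmeticFunction.moebius_eq_zero_of_not_squarefree, Int.cast_zero, zero_mul, zero_div]
        intro hdsq
        refine hdr (Nat.mem_divisors.mpr ⟨?_, hsq.ne_zero⟩)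
        rw [← Nat.prod_primeFactors_of_squarefree hdsq, ← Nat.prod_primeFactors_of_squarefree hsq,
          hpf]
        exact prod_dvd_prod_of_subset _ _ _ (Nat.primeFactors_mono (Nat.dvd_of_mem_divisors hd) hn)

/-- Any `D ≥ N` is allowed because `N / d = 0` for `d > N`; one `D` thus serves every `x` in the
range of integration. -/
theorem sum_Ioc_zero_totient_div {q : ℕ} (ψ : DirichletCharacter ℂ q) {N D : ℕ} (hND : N ≤ D) :
    ∑ n ∈ Ioc 0 N, totient ψ n / n =
      ∑ d ∈ Icc 1 D, (ArithmeticFunction.moebius d : ℂ) * ψ d / d * (N / d : ℕ) := by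
  calc _ = ∑ n ∈ Ioc 0 N, ∑ d ∈ Icc 1 D,
        if d ∣ n then (ArithmeticFunction.moebius d : ℂ) * ψ d / d else 0 := by
        refine sum_congr rfl fun n hn => ?_
        have hn' := mem_Ioc.mp hn
        rw [totient_div_eq_sum_divisors ψ (by lia), ← sum_filter]
        refine sum_congr ?_ fun _ _ => rfl
        ext d
        simp only [Nat.mem_divisors, mem_filter, mem_Icc]
        constructor
        · rintro ⟨h, _⟩
          exact ⟨⟨Nat.pos_of_dvd_of_pos h hn'.1, (Nat.le_of_dvd hn'.1 h).trans (hn'.2.trans hND)⟩, h⟩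
        · rintro ⟨_, h⟩
          exact ⟨h, by lia⟩
    _ = _ := by
        rw [sum_comm]
        refine sum_congr rfl fun d _ => ?_
        rw [← sum_filter, sum_const, Nat.Ioc_filter_dvd_card_eq_div, nsmul_eq_mul, mul_comm]

theorem natFloor_div_eq (d : ℕ) {y : ℝ} (hy : 0 ≤ y) :
    ((⌊y⌋₊ / d : ℕ) : ℝ) = y / d - Int.fract (y / d) := by
  rw [← Nat.floor_div_natCast, Int.self_sub_fract, natCast_floor_eq_intCast_floor (by positivity)]

theorem hasSum_divisorCoeff_div {q : ℕ} [NeZero q] {ψ : DirichletCharacter ℂ q}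
    (hreal : ∀ a : ZMod q, (ψ a).im = 0) :
    HasSum (fun d : ℕ => ((divisorCoeff ψ d / d : ℝ) : ℂ)) (1 / ψ.LFunction 2) := by
  have h2 : 1 < (2 : ℂ).re := by norm_num
  have h := DirichletCharacter.LSeries.mul_mu_eq_one ψ h2
  rw [← DirichletCharacter.LFunction_eq_LSeries ψ h2] at h
  have hne : ψ.LFunction 2 ≠ 0 := fun h0 => by simp [h0] at h
  replace h := eq_one_div_of_mul_eq_one_right h
  have hs := (DirichletCharacter.LSeriesSummable_mul ψ
    (ArithmeticFunction.LSeriesSummable_moebius_iff.mpr h2)).LSeriesHasSum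
  rw [h, LSeriesHasSum] at hs
  refine hs.congr_fun fun d => ?_
  rcases eq_or_ne d 0 with rfl | hd
  · simp [divisorCoeff]
  rw [LSeries.term_of_ne_zero hd, Complex.ofReal_div, ofReal_divisorCoeff hreal]
  simp only [Pi.mul_apply, Complex.ofReal_natCast]
  rw [Complex.cpow_ofNat]
  field_simp

/-- The truncation error of the series for `1 / L(2, ψ)`. -/
noncomputable def tailTerm {q : ℕ} (ψ : DirichletCharacter ℂ q) (D : ℕ) : ℝ :=
  (∑' d : ℕ, divisorCoeff ψ d / d) - ∑ d ∈ Icc 1 D, divisorCoeff ψ d / d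

theorem shortSumError_eq {q : ℕ} [NeZero q] {ψ : DirichletCharacter ℂ q}
    (hreal : ∀ a : ZMod q, (ψ a).im = 0) {H x : ℝ} (hH : 0 ≤ H) (hx : 0 ≤ x) {D : ℕ}
    (hD : x + H ≤ D) :
    shortSumError ψ H x =
      ((-(sawSum (divisorCoeff ψ) H D x + H * tailTerm ψ D) : ℝ) : ℂ) := by
  have hxH : ⌊x⌋₊ ≤ ⌊x + H⌋₊ := Nat.floor_le_floor (by linarith)
  have hfloor : ⌊x + H⌋₊ ≤ D := by
    simpa using Nat.floor_le_floor hD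
  have hL : 1 / ψ.LFunction 2 = ((∑' d : ℕ, divisorCoeff ψ d / d : ℝ) : ℂ) := by
    rw [Complex.ofReal_tsum, (hasSum_divisorCoeff_div hreal).tsum_eq]
  have hsum : ∑ n ∈ Ioc ⌊x⌋₊ ⌊x + H⌋₊, totient ψ n / n =
      ((∑ d ∈ Icc 1 D, divisorCoeff ψ d *
        (((⌊x + H⌋₊ / d : ℕ) : ℝ) - ((⌊x⌋₊ / d : ℕ) : ℝ)) : ℝ) : ℂ) := by
    have hsplit : ∑ n ∈ Ioc 0 ⌊x⌋₊, totient ψ n / n + ∑ n ∈ Ioc ⌊x⌋₊ ⌊x + H⌋₊, totient ψ n / n =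
        ∑ n ∈ Ioc 0 ⌊x + H⌋₊, totient ψ n / n :=
      sum_Ioc_consecutive _ (Nat.zero_le _) hxH
    rw [sum_Ioc_zero_totient_div ψ hfloor, sum_Ioc_zero_totient_div ψ (hxH.trans hfloor)] at hsplit
    rw [← eq_sub_iff_add_eq'] at hsplit
    rw [hsplit, ← sum_sub_distrib]
    push_cast
    refine sum_congr rfl fun d _ => ?_
    rw [ofReal_divisorCoeff hreal]
    ring
  rw [shortSumError, hsum, div_eq_mul_one_div (H : ℂ), hL, ← Complex.ofReal_mul,
    ← Complex.ofReal_sub]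
  congr 1
  have hterm (d : ℕ) : divisorCoeff ψ d * (((⌊x + H⌋₊ / d : ℕ) : ℝ) - ((⌊x⌋₊ / d : ℕ) : ℝ)) =
      H * (divisorCoeff ψ d / d) - divisorCoeff ψ d * sawDiff (H / d) (x / d) := by
    rw [natFloor_div_eq d (by linarith), natFloor_div_eq d hx, sawDiff, ← add_div]
    ring
  simp_rw [hterm]
  rw [sum_sub_distrib, ← mul_sum, tailTerm, sawSum]
  ring

theorem abs_tailTerm_le {q : ℕ} (ψ : DirichletCharacter ℂ q) {η : ℝ} (hη : 0 < η) (hη1 : η ≤ 1)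
    {D : ℕ} (hD : 0 < D) : |tailTerm ψ D| ≤ (D : ℝ) ^ (-1 + η) * zetaValue η := by
  have hD0 : (0 : ℝ) < D := by exact_mod_cast hD
  have hle (d : ℕ) : ‖divisorCoeff ψ d / d‖ ≤ 1 / (d : ℝ) ^ 2 := by
    rw [Real.norm_eq_abs, abs_div, Nat.abs_cast]
    calc _ ≤ 1 / (d : ℝ) / d := by gcongr; exact abs_divisorCoeff_le ψ d
      _ = _ := by rw [div_div, sq]
  have hs : Summable fun d : ℕ => divisorCoeff ψ d / d :=
    Summable.of_norm_bounded (Real.summable_one_div_nat_pow.mpr one_lt_two) hle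
  rw [tailTerm, ← hs.sum_add_tsum_compl (s := Icc 1 D), add_sub_cancel_left, ← Real.norm_eq_abs,
    tsum_subtype ((Icc 1 D : Finset ℕ) : Set ℕ)ᶜ (fun d : ℕ => divisorCoeff ψ d / d)]
  refine tsum_of_norm_bounded ((summable_rpow_neg_one_sub hη).hasSum.mul_left _) fun d => ?_
  by_cases hd : d ∈ Icc 1 D
  · rw [Set.indicator_of_notMem (by simpa using hd), norm_zero]; positivity
  rw [Set.indicator_of_mem (by simpa using hd)]
  rcases eq_or_ne d 0 with rfl | hd0
  · simp only [CharP.cast_eq_zero, div_zero, norm_zero]; positivity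
  have hDd : D < d := by
    rw [mem_Icc] at hd; lia
  have hdR : (0 : ℝ) < d := by positivity
  have hDd' : (D : ℝ) ≤ d := by exact_mod_cast hDd.le
  calc _ ≤ 1 / (d : ℝ) ^ 2 := hle d
    _ = (d : ℝ) ^ (-1 + η) * (d : ℝ) ^ (-1 - η) := by
        rw [← Real.rpow_add hdR, show -1 + η + (-1 - η) = -2 by ring, Real.rpow_neg hdR.le,
          Real.rpow_ofNat, one_div]
    _ ≤ _ := by
        have := Real.rpow_le_rpow_of_nonpos hD0 hDd' (show -1 + η ≤ 0 by linarith)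
        gcongr

theorem sum_abs_divisorCoeff_le {q : ℕ} (ψ : DirichletCharacter ℂ q) {η : ℝ} (hη : 0 < η) (D : ℕ) :
    ∑ d ∈ Icc 1 D, |divisorCoeff ψ d| ≤ (D : ℝ) ^ η * zetaValue η := by
  calc _ ≤ ∑ d ∈ Icc 1 D, (D : ℝ) ^ η * (d : ℝ) ^ (-1 - η) := by
        refine sum_le_sum fun d hd => (abs_divisorCoeff_le ψ d).trans ?_
        have hd' := mem_Icc.mp hd
        have hdR : (0 : ℝ) < d := by exact_mod_cast hd'.1
        have hdD : (d : ℝ) ≤ D := by exact_mod_cast hd'.2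
        calc (1 : ℝ) / d = (d : ℝ) ^ η * (d : ℝ) ^ (-1 - η) := by
              rw [← Real.rpow_add hdR, show η + (-1 - η) = -1 by ring, Real.rpow_neg_one, one_div]
          _ ≤ _ := by gcongr
    _ = (D : ℝ) ^ η * ∑ d ∈ Icc 1 D, (d : ℝ) ^ (-1 - η) := by rw [mul_sum]
    _ ≤ _ := by gcongr; exact sum_rpow_le_zetaValue hη _

theorem sum_doubleTerm_eq {q : ℕ} {ψ : DirichletCharacter ℂ q}
    (hreal : ∀ a : ZMod q, (ψ a).im = 0) (H : ℝ) (D : ℕ) :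
    ∑ p ∈ Icc 1 D ×ˢ Icc 1 D, doubleTerm ψ H p =
      ((∑ d ∈ Icc 1 D, ∑ e ∈ Icc 1 D,
        divisorCoeff ψ d * divisorCoeff ψ e * sawCorrelation H d e : ℝ) : ℂ) := by
  simp_rw [ofReal_doubleTerm hreal]
  rw [sum_product]
  push_cast
  rfl

theorem norm_shortSumError_sq_eq {q : ℕ} [NeZero q] {ψ : DirichletCharacter ℂ q}
    (hreal : ∀ a : ZMod q, (ψ a).im = 0) {H X : ℝ} (hH : 0 ≤ H) (hX : 0 ≤ X) (hHX : H ≤ X)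
    {D : ℕ} (hD : 3 * X ≤ D) {x : ℝ} (hx : x ∈ Set.uIcc X (2 * X)) :
    ‖shortSumError ψ H x‖ ^ 2 =
      (sawSum (divisorCoeff ψ) H D x + H * tailTerm ψ D) ^ 2 := by
  rw [Set.uIcc_of_le (by linarith)] at hx
  rw [shortSumError_eq hreal hH (hX.trans hx.1) (by linarith [hx.2]), Complex.norm_real,
    Real.norm_eq_abs, sq_abs, neg_sq]

theorem intervalIntegrable_norm_shortSumError_sq {q : ℕ} [NeZero q] {ψ : DirichletCharacter ℂ q}
    (hreal : ∀ a : ZMod q, (ψ a).im = 0) {H X : ℝ} (hH : 0 ≤ H) (hX : 0 ≤ X) (hHX : H ≤ X) :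
    IntervalIntegrable (fun x => ‖shortSumError ψ H x‖ ^ 2) volume X (2 * X) := by
  have h := intervalIntegrable_sub_sq (measurable_sawSum (divisorCoeff ψ) H ⌈3 * X⌉₊)
    (abs_sawSum_le (divisorCoeff ψ) H ⌈3 * X⌉₊)
    (continuous_const (y := -(H * tailTerm ψ ⌈3 * X⌉₊))) X (2 * X)
  refine h.congr fun x hx => ?_
  rw [norm_shortSumError_sq_eq hreal hH hX hHX (Nat.le_ceil _) (Set.uIoc_subset_uIcc hx),
    sub_neg_eq_add]

theorem variance_eq {q : ℕ} [NeZero q] {ψ : DirichletCharacter ℂ q}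
    (hreal : ∀ a : ZMod q, (ψ a).im = 0) {H X : ℝ} (hH : 0 ≤ H) (hX : 0 < X) (hHX : H ≤ X)
    {D : ℕ} (hD : 3 * X ≤ D) :
    variance ψ X H = 1 / X * (∫ x in X..2 * X, sawSum (divisorCoeff ψ) H D x ^ 2) +
      2 * (H * tailTerm ψ D) * (1 / X * ∫ x in X..2 * X, sawSum (divisorCoeff ψ) H D x) +
      (H * tailTerm ψ D) ^ 2 := by
  set S := sawSum (divisorCoeff ψ) H D
  set τ := H * tailTerm ψ D
  have hS : IntervalIntegrable S volume X (2 * X) :=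
    intervalIntegrable_of_measurable_of_abs_le (measurable_sawSum _ _ _) (abs_sawSum_le _ _ _) _ _
  have hS2 : IntervalIntegrable (fun x => S x ^ 2) volume X (2 * X) := by
    simpa using intervalIntegrable_sub_sq (measurable_sawSum (divisorCoeff ψ) H D)
      (abs_sawSum_le (divisorCoeff ψ) H D) (continuous_const (y := (0 : ℝ))) X (2 * X)
  have e : ∫ x in X..2 * X, ‖shortSumError ψ H x‖ ^ 2 =
      ∫ x in X..2 * X, (S x ^ 2 + (2 * τ * S x + τ ^ 2)) := by
    refine intervalIntegral.integral_congr fun x hx => ?_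
    simp only [norm_shortSumError_sq_eq hreal hH hX.le hHX hD hx]
    ring
  rw [variance, e, intervalIntegral.integral_add hS2
    ((hS.const_mul _).add intervalIntegrable_const), intervalIntegral.integral_add
    (hS.const_mul _) intervalIntegrable_const, intervalIntegral.integral_const_mul,
    intervalIntegral.integral_const, smul_eq_mul]
  field_simp
  ring

/-- Raising `H ≤ X ^ (1 - ε)` to the power `1 + ε` gives `H ^ (1 + ε) ≤ X ^ (1 - ε²)`, which
dictates the exponent `ε²`. -/
theorem mul_rpow_le_rpow_neg {ε X H : ℝ} (hε : 0 < ε) (hX : 1 ≤ X) (hH : 2 ≤ H)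
    (hHX : H ≤ X ^ (1 - ε)) : H * X ^ (ε ^ 2 - 1) ≤ H ^ (-ε) := by
  have hX0 : 0 < X := by linarith
  have hH0 : 0 < H := by linarith
  have h1 : H ^ (1 + ε) ≤ X ^ (1 - ε ^ 2) := by
    calc H ^ (1 + ε) ≤ (X ^ (1 - ε)) ^ (1 + ε) := by gcongr
      _ = _ := by rw [← Real.rpow_mul hX0.le]; congr 1; ring
  calc H * X ^ (ε ^ 2 - 1) = H ^ (-ε) * (H ^ (1 + ε) * X ^ (ε ^ 2 - 1)) := by
        rw [← mul_assoc, ← Real.rpow_add hH0, show -ε + (1 + ε) = 1 by ring, Real.rpow_one]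
    _ ≤ H ^ (-ε) * (X ^ (1 - ε ^ 2) * X ^ (ε ^ 2 - 1)) := by gcongr
    _ = _ := by
        rw [← Real.rpow_add hX0, show 1 - ε ^ 2 + (ε ^ 2 - 1) = 0 by ring, Real.rpow_zero, mul_one]

theorem exists_norm_variance_sub_constant_le {q : ℕ} [NeZero q] {ψ : DirichletCharacter ℂ q}
    (hreal : ∀ a : ZMod q, (ψ a).im = 0) {η : ℝ} (hη : 0 < η) (hη8 : η ≤ 1 / 8) :
    ∃ C : ℝ, ∀ X H : ℝ, 1 ≤ X → 1 ≤ H → H ≤ X →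
      ‖(variance ψ X H : ℂ) - constant ψ H‖ ≤ C * (H * X ^ (8 * η - 1)) := by
  obtain ⟨C, hC, hmain⟩ := exists_abs_integral_sawSum_sq_sub_le hη (by linarith)
  set z := zetaValue η with hz
  have hz0 : 0 ≤ z := zetaValue_nonneg η
  refine ⟨(C + 4 * z ^ 2) * 4, fun X H hX hH hHX => ?_⟩
  have hX0 : 0 < X := by linarith
  have hH0 : 0 ≤ H := by linarith
  -- `x + H ≤ 3 X` for `x ≤ 2 X` and `H ≤ X`.
  set D := ⌈3 * X⌉₊ with hD
  have hD3 : 3 * X ≤ D := Nat.le_ceil _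
  have hD4 : (D : ℝ) ≤ 4 * X := by
    have := Nat.ceil_lt_add_one (show 0 ≤ 3 * X by linarith)
    linarith
  have hXD : X ≤ D := by linarith
  have hD0 : (0 : ℝ) < D := by linarith
  have hD1 : (1 : ℝ) ≤ D := by linarith
  have hDn : 0 < D := by exact_mod_cast hD0
  set P : ℝ := (D : ℝ) ^ (8 * η) / X with hP
  have hpow {t : ℝ} (ht : t ≤ 8 * η) : (D : ℝ) ^ (-1 + t) ≤ P := by
    rw [Real.rpow_add hD0, Real.rpow_neg_one, hP, div_eq_mul_inv, mul_comm]
    have := Real.rpow_le_rpow_of_exponent_le hD1 ht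
    gcongr
  have hP0 : 0 ≤ P := by positivity
  have hPX : P ≤ 4 * X ^ (8 * η - 1) := by
    calc P ≤ (4 * X) ^ (8 * η) / X := by rw [hP]; gcongr
      _ = 4 ^ (8 * η) * X ^ (8 * η - 1) := by
          rw [Real.mul_rpow (by norm_num) hX0.le, Real.rpow_sub_one hX0.ne', mul_div_assoc]
      _ ≤ 4 ^ (1 : ℝ) * X ^ (8 * η - 1) := by
          have : (4 : ℝ) ^ (8 * η) ≤ 4 ^ (1 : ℝ) :=
            Real.rpow_le_rpow_of_exponent_le (by norm_num) (by linarith)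
          gcongr
      _ = _ := by rw [Real.rpow_one]
  set a := divisorCoeff ψ with ha
  set M : ℝ := ∑ d ∈ Icc 1 D, ∑ e ∈ Icc 1 D, a d * a e * sawCorrelation H d e with hM
  set I2 := ∫ x in X..2 * X, sawSum a H D x ^ 2 with hI2
  set I1 := ∫ x in X..2 * X, sawSum a H D x with hI1
  set τ := H * tailTerm ψ D with hτ
  have hmainD := hmain a (fun d _ => abs_divisorCoeff_le ψ d) H X (2 * X) D hH (by linarith)
  rw [show 2 * X - X = X by ring, ← hI2, ← hM] at hmainD
  have hA : |1 / X * I2 - M| ≤ C * (H * P) := by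
    rw [show 1 / X * I2 - M = (I2 - X * M) / X by field_simp, abs_div, abs_of_pos hX0, hP,
      div_le_iff₀ hX0]
    refine hmainD.trans (le_of_eq ?_)
    field_simp
  have hτ1 : |τ| ≤ H * ((D : ℝ) ^ (-1 + η) * z) := by
    rw [hτ, abs_mul, abs_of_nonneg hH0]
    gcongr
    exact abs_tailTerm_le ψ hη (by linarith) hDn
  -- The trivial bound on the mean suffices, as it is multiplied by the small tail `τ`.
  have hB1 : |1 / X * I1| ≤ (D : ℝ) ^ η * z := by
    have h1 : ‖I1‖ ≤ ((D : ℝ) ^ η * z) * |2 * X - X| :=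
      intervalIntegral.norm_integral_le_of_norm_le_const fun x _ =>
        (abs_sawSum_le a H D x).trans (sum_abs_divisorCoeff_le ψ hη D)
    rw [show 2 * X - X = X by ring, abs_of_pos hX0, Real.norm_eq_abs] at h1
    rw [abs_mul, abs_of_pos (show 0 < 1 / X by positivity), one_div, inv_mul_le_iff₀ hX0]
    linarith
  have hB : |2 * τ * (1 / X * I1)| ≤ 2 * z ^ 2 * (H * P) := by
    rw [abs_mul, abs_mul, abs_two]
    calc _ ≤ 2 * (H * ((D : ℝ) ^ (-1 + η) * z)) * ((D : ℝ) ^ η * z) := by gcongr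
      _ = 2 * z ^ 2 * (H * ((D : ℝ) ^ (-1 + η) * (D : ℝ) ^ η)) := by ring
      _ = 2 * z ^ 2 * (H * (D : ℝ) ^ (-1 + 2 * η)) := by
          rw [← Real.rpow_add hD0]; congr 3; ring
      _ ≤ _ := by gcongr; exact hpow (by linarith)
  have hE : |τ ^ 2| ≤ z ^ 2 * (H * P) := by
    rw [abs_pow]
    calc |τ| ^ 2 ≤ (H * ((D : ℝ) ^ (-1 + η) * z)) ^ 2 := by gcongr
      _ = z ^ 2 * (H * (H * ((D : ℝ) ^ (-1 + η) * (D : ℝ) ^ (-1 + η)))) := by ring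
      -- One of the two factors `H` is given up for `D`, leaving a bound linear in `H`.
      _ ≤ z ^ 2 * (H * (D * ((D : ℝ) ^ (-1 + η) * (D : ℝ) ^ (-1 + η)))) := by
          have := hHX.trans hXD
          gcongr
      _ = z ^ 2 * (H * (D : ℝ) ^ (-1 + 2 * η)) := by
          rw [← Real.rpow_add hD0, ← Real.rpow_one_add' hD0.le (by linarith)]
          congr 3; ring
      _ ≤ _ := by gcongr; exact hpow (by linarith)
  have hG : ‖((M : ℝ) : ℂ) - constant ψ H‖ ≤ z ^ 2 * (H * P) := by
    have hs := summable_doubleTerm hreal hH0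
    rw [constant, (hasSum_constantTerm hreal hs).tsum_eq, hM, ha, ← sum_doubleTerm_eq hreal]
    refine (abs_sum_doubleTerm_sub_tsum_le hreal hH0 hη (by linarith) hDn).trans ?_
    rw [mul_comm (z ^ 2)]
    gcongr
    exact hpow (by linarith)
  have hvar := variance_eq hreal hH0 hX0 hHX hD3
  have hreal' : |variance ψ X H - M| ≤ (C + 3 * z ^ 2) * (H * P) := by
    rw [hvar]
    calc _ = |(1 / X * I2 - M) + 2 * τ * (1 / X * I1) + τ ^ 2| := by congr 1; ring
      _ ≤ |1 / X * I2 - M| + |2 * τ * (1 / X * I1)| + |τ ^ 2| := abs_add_three _ _ _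
      _ ≤ _ := by linarith
  calc _ = ‖((variance ψ X H - M : ℝ) : ℂ) + (((M : ℝ) : ℂ) - constant ψ H)‖ := by
        congr 1; push_cast; ring
    _ ≤ |variance ψ X H - M| + z ^ 2 * (H * P) := by
        refine (norm_add_le _ _).trans ?_
        rw [Complex.norm_real, Real.norm_eq_abs]
        gcongr
    _ ≤ (C + 4 * z ^ 2) * (H * P) := by linarith
    _ ≤ (C + 4 * z ^ 2) * (H * (4 * X ^ (8 * η - 1))) := by gcongr
    _ = _ := by ring

end TwistedTotient

theorem corollary1p7 {q : ℕ} [NeZero q] (ψ : DirichletCharacter ℂ q)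
    (hreal : ∀ a : ZMod q, (ψ a).im = 0) (hψ : ψ ≠ 1) :
    (∀ d : ℕ, Multipliable (TwistedTotient.eulerFactor ψ d)) ∧
    (∀ H : ℝ, Summable (TwistedTotient.constantTerm ψ H)) ∧
    ∀ ε : ℝ, 0 < ε → ∃ C : ℝ, ∀ X H : ℝ, 1 ≤ X → 2 ≤ H → H ≤ X ^ (1 - ε) →
      IntervalIntegrable (fun x => ‖TwistedTotient.shortSumError ψ H x‖ ^ 2)
        MeasureTheory.volume X (2 * X) ∧
      ‖(TwistedTotient.variance ψ X H : ℂ) - TwistedTotient.constant ψ H‖ ≤ C * H ^ (-ε) := by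
  refine ⟨fun d => (TwistedTotient.hasProd_eulerFactor ψ d).multipliable,
    TwistedTotient.summable_constantTerm ψ, fun ε hε => ?_⟩
  rcases le_or_gt 1 ε with h1 | h1
  -- For `ε ≥ 1` the range is empty: `X ^ (1 - ε) ≤ 1 < 2 ≤ H`.
  · refine ⟨0, fun X H hX hH hHX => ?_⟩
    have := Real.rpow_le_one_of_one_le_of_nonpos hX (show 1 - ε ≤ 0 by linarith)
    linarith
  -- `8 η = ε²` turns the error into `H X ^ (ε² - 1)`; `ε < 1` ensures `η ≤ 1/8`.
  obtain ⟨C, hC⟩ := TwistedTotient.exists_norm_variance_sub_constant_le hreal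
    (η := ε ^ 2 / 8) (by positivity) (by nlinarith)
  refine ⟨|C|, fun X H hX hH hHX => ?_⟩
  have hHX' : H ≤ X := hHX.trans <| by
    simpa using Real.rpow_le_rpow_of_exponent_le hX (show 1 - ε ≤ 1 by linarith)
  have hX0 : 0 ≤ X := by linarith
  refine ⟨TwistedTotient.intervalIntegrable_norm_shortSumError_sq hreal (by linarith) hX0 hHX', ?_⟩
  have h := hC X H hX (by linarith) hHX'
  rw [show 8 * (ε ^ 2 / 8) - 1 = ε ^ 2 - 1 by ring] at h
  have hpos : 0 ≤ H * X ^ (ε ^ 2 - 1) := by positivity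
  calc _ ≤ C * (H * X ^ (ε ^ 2 - 1)) := h
    _ ≤ |C| * (H * X ^ (ε ^ 2 - 1)) := by gcongr; exact le_abs_self C
    _ ≤ _ := by gcongr; exact TwistedTotient.mul_rpow_le_rpow_neg hε hX hH hHX
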